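/- Let $\mathbb{F}$ be a field of characteristic $2$. A \emph{commutative Lie algebra} over $\mathbb{F}$ is an $\mathbb{F}$-vector space $\mathfrak{g}$ with a bilinear bracket satisfying $[x,y]=[y,x]$ and $[x,[y,z]]+[y,[z,x]]+[z,[x,y]]=0$; a \emph{$\mathfrak{g}$-module} is a vector space $M$ with a bilinear map $\mathfrak{g}\times M\to M$, $(x,m)\mapsto x\cdot m$, such that $[x,y]\cdot m=x\cdot(y\cdot m)+y\cdot(x\cdot m)$. Let $CS^n(\mathfrak{g},M)=\mathrm{Hom}_{\mathbb{F}}(S^n\mathfrak{g},M)$ be the space of symmetric $n$-linear maps $\mathfrak{g}^n\to M$, with the differential $$df(x_1,\dots,x_{n+1})=\sum_{i} x_i\cdot f(\dots,\hat x_i,\dots)+\sum_{i<j} f([x_i,x_j],x_1,\dots,\hat x_i,\dots,\hat x_j,\dots,x_{n+1}),$$ and let $HS^n(\mathfrak{g},M)$ be the cohomology of this complex. Let $0\to\mathfrak{h}\to\mathfrak{g}\to\mathfrak{q}\to 0$ be a short exact sequence of commutative Lie algebras over $\mathbb{F}$ and let $M$ be a $\mathfrak{g}$-module. Let $\mathcal{F}^pCS^n(\mathfrak{g},M)$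 be the space of all $c\in CS^n(\mathfrak{g},M)$ with $c(x_1,\dots,x_n)=0$ whenever at least $n-p+1$ of the $x_i$ belong to $\mathfrak{h}$; this is a decreasing filtration of $CS^\bullet(\mathfrak{g},M)$ by subcomplexes. The action of $\mathfrak{g}$ on $CS^q(\mathfrak{h},M)$ by $(x\cdot f)(y_1,\dots,y_q)=x\cdot f(y_1,\dots,y_q)+\sum_i f(y_1,\dots,[x,y_i],\dots,y_q)$ induces a $\mathfrak{q}$-module structure on $HS^q(\mathfrak{h},M)$. Then the spectral sequence of this filtration, i.e. the first quadrant cohomological spectral sequence with pages $$E_r^{p,q}=Z_r^{p,q}/(Z_{r-1}^{p+1,q-1}+dZ_{r-1}^{p-r+1,q+r-2}),\qquad Z_r^{p,q}=\{c\in\mathcal{F}^pCS^{p+q}(\mathfrak{g},M)\mid dc\in\mathcal{F}^{p+r}CS^{p+q+1}(\mathfrak{g},M)\}\qquad(r\ge 0),$$ with differentials $d_r:E_r^{p,q}\to E_r^{p+r,q-r+1}$ induced by $d$ and with the isomorphisms $H(E_r)\cong E_{r+1}$ that are the identity on representatives in $Z_{r+1}$, has the following properties. 1. For all $p,q\ge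 0$ there is a linear isomorphism $$E_2^{p,q}\cong HS^p(\mathfrak{q},HS^q(\mathfrak{h},M)).$$ It is induced by restriction of cochains: the class of $f\in Z_2^{p,q}$ is sent to the class of a cocycle $\varphi\in CS^p(\mathfrak{q},HS^q(\mathfrak{h},M))$ such that, for all $x_1,\dots,x_p\in\mathfrak{g}$ with images $\bar x_i\in\mathfrak{q}$, the map $(y_1,\dots,y_q)\mapsto f(x_1,\dots,x_p,y_1,\dots,y_q)$ on $\mathfrak{h}^q$ is a cocycle with class $\varphi(\bar x_1,\dots,\bar x_p)$. 2. It converges to $HS^\bullet(\mathfrak{g},M)$: let $\mathcal{F}^pHS^n(\mathfrak{g},M)$ be the space of classes of cocycles in $\mathcal{F}^pCS^n(\mathfrak{g},M)$. Then $\mathcal{F}^0HS^n(\mathfrak{g},M)=HS^n(\mathfrak{g},M)$ and $\mathcal{F}^{n+1}HS^n(\mathfrak{g},M)=0$, and for all $p,q\ge 0$ and all $r>\max(p,q+1)$, sending the class of a cochain in $Z_r^{p,q}$ (which is then a cocycle) to its cohomology class induces an isomorphism $$E_r^{p,q}\cong\mathcal{F}^pHS^{p+q}(\mathfrak{g},M)/\mathcal{F}^{p+1}HS^{p+q}(\mathfrak{g},M).$$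 -/

import Mathlib

open CategoryTheory

/-! ### Commutative Lie algebras, their modules and extensions -/

/-- A commutative Lie algebra over `𝔽`: a bilinear bracket which is symmetric and satisfies the
Jacobi identity (`[x, x] = 0` is not required). Meant for fields of characteristic `2`. -/
class CommLieAlgebra (𝔽 L : Type*) [Field 𝔽] [AddCommGroup L] [Module 𝔽 L] where
  bracket : L →ₗ[𝔽] L →ₗ[𝔽] L
  bracket_comm : ∀ x y, bracket x y = bracket y x
  jacobi : ∀ x y z,
    bracket x (bracket y z) + bracket y (bracket z x) + bracket z (bracket x y) = 0

/-- The bracket `(x, y) ↦ [x, y]` of a commutative Lie algebra, as a bilinear map. -/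
abbrev lieBr (𝔽 : Type*) {L : Type*} [Field 𝔽] [AddCommGroup L] [Module 𝔽 L]
    [CommLieAlgebra 𝔽 L] : L →ₗ[𝔽] L →ₗ[𝔽] L :=
  CommLieAlgebra.bracket

/-- The structure of an `L`-module on the vector space `M`:
`[x, y] · m = x · (y · m) + y · (x · m)`. -/
structure CommLieRep (𝔽 L M : Type*) [Field 𝔽] [AddCommGroup L] [Module 𝔽 L]
    [CommLieAlgebra 𝔽 L] [AddCommGroup M] [Module 𝔽 M] where
  act : L →ₗ[𝔽] M →ₗ[𝔽] M
  act_bracket : ∀ x y m, act (lieBr 𝔽 x y) m = act x (act y m) + act y (act x m)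

/-- An extension `0 → h → g → q → 0` of commutative Lie algebras. -/
structure CommLieExtension (𝔽 h g q : Type*) [Field 𝔽]
    [AddCommGroup h] [Module 𝔽 h] [CommLieAlgebra 𝔽 h]
    [AddCommGroup g] [Module 𝔽 g] [CommLieAlgebra 𝔽 g]
    [AddCommGroup q] [Module 𝔽 q] [CommLieAlgebra 𝔽 q] where
  incl : h →ₗ[𝔽] g
  proj : g →ₗ[𝔽] q
  incl_bracket : ∀ x y, incl (lieBr 𝔽 x y) = lieBr 𝔽 (incl x) (incl y)
  proj_bracket : ∀ x y, proj (lieBr 𝔽 x y) = lieBr 𝔽 (proj x) (proj y)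
  incl_injective : Function.Injective incl
  exact : Function.Exact incl proj
  proj_surjective : Function.Surjective proj

/-! ### Multilinear cochains and the Cartan calculus -/

namespace CommLie

section Multilinear

variable {𝔽 L M : Type*} [Field 𝔽] [AddCommGroup L] [Module 𝔽 L] [AddCommGroup M] [Module 𝔽 M]

theorem add_self [CharP 𝔽 2] (m : M) : m + m = 0 := by
  rw [← two_smul 𝔽 m, CharTwo.two_eq_zero, zero_smul]

theorem add_cancel_mid [CharP 𝔽 2] (a b c : M) : (a + b) + (b + c) = a + c := by
  have := add_self (𝔽 := 𝔽) b
  calc (a + b) + (b + c) = a + c + (b + b) := by abel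
    _ = a + c := by rw [this, add_zero]

variable (𝔽 L M) in
/-- `n`-linear maps `L × ⋯ × L → M`. -/
abbrev ML (n : ℕ) := MultilinearMap 𝔽 (fun _ : Fin n => L) M

/-- For endomorphisms `A` of `M` and `D` of `L`, the operator
`(θ f)(y₁, …, yₙ) = A f(y₁, …, yₙ) + ∑ᵢ f(y₁, …, D yᵢ, …, yₙ)`. -/
def theta (A : M →ₗ[𝔽] M) (D : L →ₗ[𝔽] L) (n : ℕ) : ML 𝔽 L M n →ₗ[𝔽] ML 𝔽 L M n where
  toFun f := A.compMultilinearMap f +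
    ∑ i, f.compLinearMap (Function.update (fun _ => LinearMap.id) i D)
  map_add' f g := by
    ext y
    simp [Finset.sum_add_distrib]
    abel
  map_smul' c f := by
    ext y
    simp [Finset.smul_sum]

theorem theta_apply (A : M →ₗ[𝔽] M) (D : L →ₗ[𝔽] L) (n : ℕ) (f : ML 𝔽 L M n) (y : Fin n → L) :
    theta A D n f y = A (f y) + ∑ i, f (Function.update y i (D (y i))) := by
  simp only [theta, LinearMap.coe_mk, AddHom.coe_mk, add_apply,
    LinearMap.compMultilinearMap_apply, sum_apply, MultilinearMap.compLinearMap_apply]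
  congr 1
  refine Finset.sum_congr rfl fun i _ => ?_
  congr 1
  funext j
  by_cases hj : j = i
  · subst hj; simp
  · simp [hj]

theorem theta_zero_apply (A : M →ₗ[𝔽] M) (D : L →ₗ[𝔽] L) (f : ML 𝔽 L M 0) (y : Fin 0 → L) :
    theta A D 0 f y = A (f y) := by
  simp [theta_apply]

/-- The insertion operator `(i_x f)(y₁, …, yₙ) = f(x, y₁, …, yₙ)`. -/
def ins (x : L) (n : ℕ) : ML 𝔽 L M (n + 1) →ₗ[𝔽] ML 𝔽 L M n where
  toFun f := f.curryLeft x
  map_add' _ _ := rfl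
  map_smul' _ _ := rfl

theorem ins_apply (x : L) (n : ℕ) (f : ML 𝔽 L M (n + 1)) (y : Fin n → L) :
    ins x n f y = f (Fin.cons x y) := rfl

theorem ins_add (x x' : L) (n : ℕ) (f : ML 𝔽 L M (n + 1)) :
    ins (x + x') n f = ins x n f + ins x' n f :=
  map_add f.curryLeft x x'

theorem ins_smul (c : 𝔽) (x : L) (n : ℕ) (f : ML 𝔽 L M (n + 1)) :
    ins (c • x) n f = c • ins x n f :=
  map_smul f.curryLeft c x

theorem ext_ins {n : ℕ} {f g : ML 𝔽 L M (n + 1)} (h : ∀ x, ins x n f = ins x n g) : f = g := by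
  ext y
  have := congrArg (fun F : ML 𝔽 L M n => F (Fin.tail y)) (h (y 0))
  simpa [ins_apply] using this

theorem ins_theta (A : M →ₗ[𝔽] M) (D : L →ₗ[𝔽] L) (n : ℕ) (f : ML 𝔽 L M (n + 1)) (x : L) :
    ins x n (theta A D (n + 1) f) = theta A D n (ins x n f) + ins (D x) n f := by
  ext y
  simp only [ins_apply, theta_apply, add_apply,
    Fin.sum_univ_succ, Fin.cons_zero, Fin.cons_succ, Fin.cons_update, Fin.update_cons_zero]
  abel

theorem theta_add (A A' : M →ₗ[𝔽] M) (D D' : L →ₗ[𝔽] L) (n : ℕ) (f : ML 𝔽 L M n) :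
    theta (A + A') (D + D') n f = theta A D n f + theta A' D' n f := by
  ext y
  simp only [theta_apply, add_apply, LinearMap.add_apply,
    MultilinearMap.map_update_add, Finset.sum_add_distrib]
  abel

theorem theta_smul (c : 𝔽) (A : M →ₗ[𝔽] M) (D : L →ₗ[𝔽] L) (n : ℕ) (f : ML 𝔽 L M n) :
    theta (c • A) (c • D) n f = c • theta A D n f := by
  ext y
  simp only [theta_apply, smul_apply, LinearMap.smul_apply,
    MultilinearMap.map_update_smul, smul_add, Finset.smul_sum]

theorem theta_comm [CharP 𝔽 2] (A A' : M →ₗ[𝔽] M) (D D' : L →ₗ[𝔽] L) (n : ℕ) (f : ML 𝔽 L M n) :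
    theta A D n (theta A' D' n f) + theta A' D' n (theta A D n f) =
      theta (A ∘ₗ A' + A' ∘ₗ A) (D ∘ₗ D' + D' ∘ₗ D) n f := by
  induction n with
  | zero =>
    ext y
    simp [theta_zero_apply]
  | succ n ih =>
    refine ext_ins fun x => ?_
    rw [ins_theta, ← ih]
    simp only [ins_theta, map_add, LinearMap.add_apply, LinearMap.comp_apply, ins_add]
    have h1 := add_self (𝔽 := 𝔽) (theta A D n (ins (D' x) n f))
    have h2 := add_self (𝔽 := 𝔽) (theta A' D' n (ins (D x) n f))
    linear_combination (norm := module) h1 + h2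

variable [CommLieAlgebra 𝔽 L] (ρ : CommLieRep 𝔽 L M)

/-- The Lie derivative
`(L_x f)(y₁, …, yₙ) = x · f(y₁, …, yₙ) + ∑ᵢ f(y₁, …, [x, yᵢ], …, yₙ)`. -/
abbrev lieDer (x : L) (n : ℕ) : ML 𝔽 L M n →ₗ[𝔽] ML 𝔽 L M n :=
  theta (ρ.act x) (lieBr 𝔽 x) n

/-- The Chevalley-Eilenberg formula
`∑ᵢ xᵢ · f(x₀, …, x̂ᵢ, …, xₙ) + ∑_{i < j} f(x₀, …, x̂ᵢ, …, [xᵢ, xⱼ], …, xₙ)`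
with `[xᵢ, xⱼ]` in the place of `xⱼ`. The indices `j > i` are written as `i.succAbove j`. For
symmetric `f` the place of `[xᵢ, xⱼ]` does not matter; see `CommLie.ceSum_eq_of_symmetric`. -/
def ceSum {n : ℕ} (f : (Fin n → L) → M) (x : Fin (n + 1) → L) : M :=
  ∑ i, ρ.act (x i) (f (i.removeNth x)) +
    ∑ i, ∑ j, if i < i.succAbove j then
      f (Function.update (i.removeNth x) j (lieBr 𝔽 (x i) (x (i.succAbove j)))) else 0

theorem ceSum_cons {n : ℕ} (f : ML 𝔽 L M (n + 1)) (x : L) (y : Fin (n + 1) → L) :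
    ceSum ρ f (Fin.cons x y : Fin (n + 2) → L) = lieDer ρ x (n + 1) f y + ceSum ρ (ins x n f) y := by
  have hrem : ∀ i : Fin (n + 1), (i.succ.removeNth (Fin.cons x y : Fin (n + 2) → L)) =
      (Fin.cons x (i.removeNth y) : Fin (n + 1) → L) := by
    intro i
    funext k
    refine Fin.cases ?_ (fun k => ?_) k <;> simp [Fin.removeNth]
  simp only [ceSum, theta_apply]
  rw [Fin.sum_univ_succ, Fin.sum_univ_succ (f := fun i : Fin (n + 2) => ∑ j : Fin (n + 1), _)]
  simp only [hrem, Fin.removeNth_zero, Fin.tail_cons, Fin.cons_zero, Fin.cons_succ, ins_apply]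
  have h0 : ∀ i : Fin (n + 1), (∑ j : Fin (n + 1), if i.succ < i.succ.succAbove j then
      f (Function.update (Fin.cons x (i.removeNth y) : Fin (n + 1) → L) j
        (lieBr 𝔽 (y i) ((Fin.cons x y : Fin (n + 2) → L) (i.succ.succAbove j)))) else 0) =
      ∑ j : Fin n, if i < i.succAbove j then
        f (Fin.cons x (Function.update (i.removeNth y) j (lieBr 𝔽 (y i) (y (i.succAbove j)))))
        else 0 := by
    intro i
    rw [Fin.sum_univ_succ]
    simp [Fin.cons_update]
  simp only [h0]
  simp
  abel

theorem ceSum_zero (f : ML 𝔽 L M 0) (x : Fin 1 → L) :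
    ceSum ρ f x = lieDer ρ (x 0) 0 f (Fin.tail x) := by
  simp [ceSum, theta_apply]

/-- The Chevalley-Eilenberg differential, built by recursion on the number of arguments. -/
def ceAux : (n : ℕ) → ML 𝔽 L M n →ₗ[𝔽] ML 𝔽 L M (n + 1)
  | 0 =>
    { toFun := fun f => LinearMap.uncurryLeft
        { toFun := fun x => lieDer ρ x 0 f
          map_add' := fun x y => by rw [lieDer, map_add, map_add, theta_add]
          map_smul' := fun c x => by rw [lieDer, map_smul, map_smul, theta_smul]; rfl }
      map_add' := fun f g => by ext; simp
      map_smul' := fun c f => by ext; simp }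
  | n + 1 =>
    { toFun := fun f => LinearMap.uncurryLeft
        { toFun := fun x => lieDer ρ x (n + 1) f + ceAux n (ins x n f)
          map_add' := fun x y => by
            rw [lieDer, map_add, map_add, theta_add, ins_add, map_add]; abel
          map_smul' := fun c x => by
            rw [lieDer, map_smul, map_smul, theta_smul, ins_smul, map_smul, ← smul_add]; rfl }
      map_add' := fun f g => by ext; simp; abel
      map_smul' := fun c f => by ext; simp }

theorem ceAux_apply (n : ℕ) (f : ML 𝔽 L M n) (x : Fin (n + 1) → L) :
    ceAux ρ n f x = ceSum ρ f x := by
  induction n with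
  | zero => rw [ceSum_zero]; rfl
  | succ n ih =>
    obtain ⟨x0, y, rfl⟩ : ∃ x0 y, x = Fin.cons x0 y := ⟨x 0, Fin.tail x, (Fin.cons_self_tail x).symm⟩
    rw [ceSum_cons, ← ih]
    simp [ceAux]

/-- The Chevalley-Eilenberg differential on multilinear cochains. -/
def ce (n : ℕ) : ML 𝔽 L M n →ₗ[𝔽] ML 𝔽 L M (n + 1) where
  toFun f :=
    { toFun := fun x => ceSum ρ f x
      map_update_add' := fun x i a b => by
        simp only [← ceAux_apply]
        convert! (ceAux ρ n f).map_update_add x i a b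
      map_update_smul' := fun x i c a => by
        simp only [← ceAux_apply]
        convert! (ceAux ρ n f).map_update_smul x i c a }
  map_add' f g := by
    ext x
    change ceSum ρ (f + g : ML 𝔽 L M n) x = ceSum ρ f x + ceSum ρ g x
    rw [← ceAux_apply, ← ceAux_apply, ← ceAux_apply, map_add]
    rfl
  map_smul' c f := by
    ext x
    change ceSum ρ (c • f : ML 𝔽 L M n) x = c • ceSum ρ f x
    rw [← ceAux_apply, ← ceAux_apply, map_smul]
    rfl

theorem ce_apply (n : ℕ) (f : ML 𝔽 L M n) (x : Fin (n + 1) → L) : ce ρ n f x = ceSum ρ f x := rfl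

theorem ins_ce_zero (f : ML 𝔽 L M 0) (x : L) : ins x 0 (ce ρ 0 f) = lieDer ρ x 0 f := by
  ext y
  rw [ins_apply, ce_apply, ceSum_zero, Fin.tail_cons, Fin.cons_zero]

/-- Cartan's formula `i_x d + d i_x = L_x` (in characteristic `2`). -/
theorem ins_ce_succ (n : ℕ) (f : ML 𝔽 L M (n + 1)) (x : L) :
    ins x (n + 1) (ce ρ (n + 1) f) = lieDer ρ x (n + 1) f + ce ρ n (ins x n f) := by
  ext y
  rw [ins_apply, ce_apply, ceSum_cons]
  rfl

/-- `A`, `D` is a compatible pair: `D` is a derivation of `L` and `A (y · m) = y · A m + D y · m`. -/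
structure IsDerPair (A : M →ₗ[𝔽] M) (D : L →ₗ[𝔽] L) : Prop where
  der : ∀ x y, D (lieBr 𝔽 x y) = lieBr 𝔽 (D x) y + lieBr 𝔽 x (D y)
  act : ∀ y m, A (ρ.act y m) = ρ.act y (A m) + ρ.act (D y) m

variable {ρ}

theorem IsDerPair.theta_lieDer [CharP 𝔽 2] {A : M →ₗ[𝔽] M} {D : L →ₗ[𝔽] L}
    (h : IsDerPair ρ A D) (n : ℕ) (x : L) (f : ML 𝔽 L M n) :
    theta A D n (lieDer ρ x n f) = lieDer ρ x n (theta A D n f) + lieDer ρ (D x) n f := by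
  have h1 : A ∘ₗ ρ.act x + ρ.act x ∘ₗ A = ρ.act (D x) := by
    ext m
    have := add_self (𝔽 := 𝔽) (ρ.act x (A m))
    simp only [LinearMap.add_apply, LinearMap.comp_apply, h.act]
    linear_combination (norm := module) this
  have h2 : D ∘ₗ lieBr 𝔽 x + lieBr 𝔽 x ∘ₗ D = lieBr 𝔽 (D x) := by
    ext y
    have := add_self (𝔽 := 𝔽) (lieBr 𝔽 x (D y))
    simp only [LinearMap.add_apply, LinearMap.comp_apply, h.der]
    linear_combination (norm := module) this
  have h3 := theta_comm A (ρ.act x) D (lieBr 𝔽 x) n f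
  rw [h1, h2] at h3
  have h4 := add_self (𝔽 := 𝔽) (lieDer ρ x n (theta A D n f))
  rw [← h3]
  linear_combination (norm := module) -h4

theorem IsDerPair.theta_ce [CharP 𝔽 2] {A : M →ₗ[𝔽] M} {D : L →ₗ[𝔽] L}
    (h : IsDerPair ρ A D) (n : ℕ) (f : ML 𝔽 L M n) :
    theta A D (n + 1) (ce ρ n f) = ce ρ n (theta A D n f) := by
  induction n with
  | zero =>
    refine ext_ins fun x => ?_
    rw [ins_theta, ins_ce_zero, ins_ce_zero, ins_ce_zero, h.theta_lieDer]
    have h1 := add_self (𝔽 := 𝔽) (lieDer ρ (D x) 0 f)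
    linear_combination (norm := module) h1
  | succ n ih =>
    refine ext_ins fun x => ?_
    rw [ins_theta, ins_ce_succ, ins_ce_succ, ins_ce_succ, map_add, ih, h.theta_lieDer, ins_theta,
      map_add]
    have h1 := add_self (𝔽 := 𝔽) (lieDer ρ (D x) (n + 1) f)
    linear_combination (norm := module) h1

variable (ρ)

theorem isDerPair_lieDer [CharP 𝔽 2] (x : L) : IsDerPair ρ (ρ.act x) (lieBr 𝔽 x) where
  der y z := by
    have h := CommLieAlgebra.jacobi (𝔽 := 𝔽) x y z
    have h1 := add_self (𝔽 := 𝔽) (lieBr 𝔽 (lieBr 𝔽 x y) z)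
    have h2 := add_self (𝔽 := 𝔽) (lieBr 𝔽 y (lieBr 𝔽 x z))
    rw [CommLieAlgebra.bracket_comm z x, CommLieAlgebra.bracket_comm z] at h
    linear_combination (norm := module) h - h1 - h2
  act y m := by
    rw [ρ.act_bracket]
    have h2 := add_self (𝔽 := 𝔽) (ρ.act y (ρ.act x m))
    linear_combination (norm := module) -h2

theorem ce_ce [CharP 𝔽 2] (n : ℕ) (f : ML 𝔽 L M n) : ce ρ (n + 1) (ce ρ n f) = 0 := by
  induction n with
  | zero =>
    refine ext_ins fun x => ?_
    rw [ins_ce_succ, ins_ce_zero, (isDerPair_lieDer ρ x).theta_ce, add_self (𝔽 := 𝔽), map_zero]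
  | succ n ih =>
    refine ext_ins fun x => ?_
    rw [ins_ce_succ, ins_ce_succ, map_add, ih, add_zero, (isDerPair_lieDer ρ x).theta_ce,
      add_self (𝔽 := 𝔽), map_zero]

end Multilinear

/-! ### Symmetric cochains -/

section Symmetric

variable {𝔽 L M : Type*} [Field 𝔽] [AddCommGroup L] [Module 𝔽 L] [AddCommGroup M] [Module 𝔽 M]

variable (𝔽 L M) in
/-- `CSⁿ(L, M) = Hom(Sⁿ L, M)`: the symmetric `n`-linear maps `L × ⋯ × L → M`. -/
def CS (n : ℕ) : Submodule 𝔽 (ML 𝔽 L M n) where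
  carrier := {f | ∀ (σ : Equiv.Perm (Fin n)) (x : Fin n → L), f (x ∘ σ) = f x}
  add_mem' := fun hf hg σ x => by simp [hf σ x, hg σ x]
  zero_mem' := fun σ x => rfl
  smul_mem' := fun c f hf σ x => by simp [hf σ x]

theorem mem_CS {n : ℕ} {f : ML 𝔽 L M n} :
    f ∈ CS 𝔽 L M n ↔ ∀ (σ : Equiv.Perm (Fin n)) (x : Fin n → L), f (x ∘ σ) = f x := Iff.rfl

theorem ins_mem_CS {n : ℕ} {f : ML 𝔽 L M (n + 1)} (hf : f ∈ CS 𝔽 L M (n + 1)) (x : L) :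
    ins x n f ∈ CS 𝔽 L M n := by
  intro σ y
  rw [ins_apply, ins_apply, ← hf (Equiv.Perm.decomposeFin.symm (0, σ)) (Fin.cons x y)]
  congr 1
  funext k
  refine Fin.cases ?_ (fun k => ?_) k <;> simp

theorem ins_ins_of_mem_CS {n : ℕ} {f : ML 𝔽 L M (n + 2)} (hf : f ∈ CS 𝔽 L M (n + 2)) (x y : L) :
    ins x n (ins y (n + 1) f) = ins y n (ins x (n + 1) f) := by
  ext z
  rw [ins_apply, ins_apply, ins_apply, ins_apply, ← hf (Equiv.swap 0 1)]
  congr 1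
  funext k
  refine Fin.cases ?_ (fun k => Fin.cases ?_ (fun k => ?_) k) k
  · simp
  · simp
  · have h1 : Equiv.swap (0 : Fin (n + 2)) 1 k.succ.succ = k.succ.succ :=
      Equiv.swap_apply_of_ne_of_ne (Fin.succ_ne_zero _)
        (by intro h; rw [← Fin.succ_zero_eq_one] at h
            exact Fin.succ_ne_zero _ (Fin.succ_injective _ h))
    simp [h1]

theorem mem_CS_zero (f : ML 𝔽 L M 0) : f ∈ CS 𝔽 L M 0 := by
  intro σ x
  congr 1
  exact Subsingleton.elim _ _

theorem mem_CS_one (f : ML 𝔽 L M 1) : f ∈ CS 𝔽 L M 1 := by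
  intro σ x
  rw [Subsingleton.elim σ 1]; rfl

theorem mem_CS_of_ins {n : ℕ} {f : ML 𝔽 L M (n + 2)} (h1 : ∀ x, ins x (n + 1) f ∈ CS 𝔽 L M (n + 1))
    (h2 : ∀ x y, ins x n (ins y (n + 1) f) = ins y n (ins x (n + 1) f)) : f ∈ CS 𝔽 L M (n + 2) := by
  intro σ
  have hσ : σ ∈ Submonoid.closure
      (Set.range fun i : Fin (n + 1) => Equiv.swap i.castSucc i.succ) := by
    rw [Equiv.Perm.mclosure_swap_castSucc_succ]; trivial
  induction hσ using Submonoid.closure_induction with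
  | one => intro x; rfl
  | mul a b _ _ ha hb =>
    intro x
    have : x ∘ ⇑(a * b) = (x ∘ a) ∘ b := rfl
    rw [this, hb, ha]
  | mem s hs =>
    obtain ⟨i, rfl⟩ := hs
    intro x
    obtain ⟨x0, y, rfl⟩ : ∃ x0 y, x = Fin.cons x0 y := ⟨x 0, Fin.tail x, (Fin.cons_self_tail x).symm⟩
    revert i
    refine Fin.cases ?_ fun i => ?_
    · obtain ⟨x1, z, rfl⟩ : ∃ x1 z, y = Fin.cons x1 z :=
        ⟨y 0, Fin.tail y, (Fin.cons_self_tail y).symm⟩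
      have h := congrArg (fun F : ML 𝔽 L M n => F z) (h2 x0 x1)
      simp only [ins_apply] at h
      rw [← h]
      congr 1
      funext k
      refine Fin.cases ?_ (fun k => Fin.cases ?_ (fun k => ?_) k) k
      · simp
      · simp
      · have h1 : Equiv.swap (0 : Fin (n + 2)) 1 k.succ.succ = k.succ.succ :=
          Equiv.swap_apply_of_ne_of_ne (Fin.succ_ne_zero _)
            (by intro h; rw [← Fin.succ_zero_eq_one] at h
                exact Fin.succ_ne_zero _ (Fin.succ_injective _ h))
        simp [h1]
    · have h := h1 x0 (Equiv.swap i.castSucc i.succ) y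
      rw [ins_apply, ins_apply] at h
      rw [← h]
      congr 1
      funext k
      refine Fin.cases ?_ (fun k => ?_) k
      · have : Equiv.swap (i.succ.castSucc : Fin (n + 2)) i.succ.succ 0 = 0 :=
          Equiv.swap_apply_of_ne_of_ne (by rw [← Fin.succ_castSucc]; exact (Fin.succ_ne_zero _).symm)
            (Fin.succ_ne_zero _).symm
        simp only [Function.comp_apply, this, Fin.cons_zero]
      · have : Equiv.swap (i.succ.castSucc : Fin (n + 2)) i.succ.succ k.succ =
            (Equiv.swap i.castSucc i.succ k).succ := by
          rw [← Fin.succ_castSucc]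
          exact (Fin.succ_injective (n + 1)).swap_apply _ _ _
        simp only [Function.comp_apply, this, Fin.cons_succ]

theorem theta_mem_CS (A : M →ₗ[𝔽] M) (D : L →ₗ[𝔽] L) {n : ℕ} {f : ML 𝔽 L M n}
    (hf : f ∈ CS 𝔽 L M n) : theta A D n f ∈ CS 𝔽 L M n := by
  intro σ x
  rw [theta_apply, theta_apply, hf]
  congr 1
  rw [← Equiv.sum_comp σ fun i => f (Function.update x i (D (x i)))]
  refine Finset.sum_congr rfl fun i _ => ?_
  rw [← hf σ (Function.update x (σ i) _)]
  congr 1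
  rw [Function.update_comp_equiv]
  simp

variable [CommLieAlgebra 𝔽 L] (ρ : CommLieRep 𝔽 L M)

theorem ce_mem_CS {n : ℕ} {f : ML 𝔽 L M n} (hf : f ∈ CS 𝔽 L M n) :
    ce ρ n f ∈ CS 𝔽 L M (n + 1) := by
  induction n with
  | zero => exact mem_CS_one _
  | succ n ih =>
    refine mem_CS_of_ins (fun x => ?_) fun x y => ?_
    · rw [ins_ce_succ]
      exact add_mem (theta_mem_CS _ _ hf) (ih (ins_mem_CS hf x))
    · rw [ins_ce_succ, ins_ce_succ, map_add, map_add, ins_theta, ins_theta]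
      cases n with
      | zero =>
        rw [ins_ce_zero, ins_ce_zero, CommLieAlgebra.bracket_comm y x]
        abel
      | succ n =>
        rw [ins_ce_succ, ins_ce_succ, CommLieAlgebra.bracket_comm y x, ins_ins_of_mem_CS hf]
        abel

/-- For symmetric `f`, the formula defining the differential is the usual one,
`∑ᵢ xᵢ · f(…, x̂ᵢ, …) + ∑_{i < j} f([xᵢ, xⱼ], …, x̂ᵢ, …, x̂ⱼ, …)`. -/
theorem ceSum_eq_of_symmetric {n : ℕ} {f : ML 𝔽 L M (n + 1)} (hf : f ∈ CS 𝔽 L M (n + 1))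
    (x : Fin (n + 2) → L) :
    ceSum ρ f x = ∑ i, ρ.act (x i) (f (i.removeNth x)) +
      ∑ i, ∑ j, if i < i.succAbove j then
        f (Fin.cons (lieBr 𝔽 (x i) (x (i.succAbove j))) (j.removeNth (i.removeNth x))) else 0 := by
  have h : ∀ (y : Fin (n + 1) → L) (j : Fin (n + 1)) (b : L),
      f (Function.update y j b) = f (Fin.cons b (j.removeNth y)) := by
    intro y j b
    rw [← hf j.cycleRange (Fin.cons b (j.removeNth y)), Fin.cons_comp_cycleRange,
      Fin.insertNth_removeNth]
  simp only [ceSum, h]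

end Symmetric

/-! ### The cochain complex and commutative cohomology -/

section Cohomology

universe u v w

variable {𝔽 : Type u} {L : Type v} {M : Type w} [Field 𝔽] [AddCommGroup L] [Module 𝔽 L]
  [AddCommGroup M] [Module 𝔽 M] [CommLieAlgebra 𝔽 L]

/-- The Chevalley-Eilenberg differential `CSⁿ(L, M) → CSⁿ⁺¹(L, M)`. -/
def dCS (ρ : CommLieRep 𝔽 L M) (n : ℕ) : CS 𝔽 L M n →ₗ[𝔽] CS 𝔽 L M (n + 1) :=
  (ce ρ n).restrict fun _ hf => ce_mem_CS ρ hf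

variable [CharP 𝔽 2]

/-- The cochain complex `CS^•(L, M)`. -/
noncomputable def csComplex (ρ : CommLieRep 𝔽 L M) : CochainComplex (ModuleCat.{max v w} 𝔽) ℕ :=
  CochainComplex.of (fun n => ModuleCat.of 𝔽 (CS 𝔽 L M n)) (fun n => ModuleCat.ofHom (dCS ρ n))
    fun n => by
      ext f : 3
      exact ce_ce ρ n _

/-- A degree `n` element of the cochain complex, as an `n`-linear map. -/
def ev (ρ : CommLieRep 𝔽 L M) (n : ℕ) : (csComplex ρ).X n →ₗ[𝔽] ML 𝔽 L M n :=
  (CS 𝔽 L M n).subtype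

theorem ev_injective (ρ : CommLieRep 𝔽 L M) (n : ℕ) : Function.Injective (ev ρ n) :=
  Subtype.val_injective

theorem ev_mem (ρ : CommLieRep 𝔽 L M) (n : ℕ) (f : (csComplex ρ).X n) : ev ρ n f ∈ CS 𝔽 L M n :=
  Subtype.property (p := fun f => f ∈ CS 𝔽 L M n) f

theorem csComplex_d (ρ : CommLieRep 𝔽 L M) (n : ℕ) :
    (csComplex ρ).d n (n + 1) = ModuleCat.ofHom (dCS ρ n) :=
  CochainComplex.of_d (fun n => ModuleCat.of 𝔽 (CS 𝔽 L M n)) (fun n => ModuleCat.ofHom (dCS ρ n)) n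

theorem ev_d (ρ : CommLieRep 𝔽 L M) (n : ℕ) (f : (csComplex ρ).X n) :
    ev ρ (n + 1) ((csComplex ρ).d n (n + 1) f) = ce ρ n (ev ρ n f) := by
  rw [csComplex_d]; rfl

/-- Commutative cohomology `HSⁿ(L, M)`. -/
noncomputable abbrev HS (ρ : CommLieRep 𝔽 L M) (n : ℕ) : ModuleCat.{max v w} 𝔽 :=
  (csComplex ρ).homology n

/-- The cochain map `θ` attached to a compatible pair of endomorphisms of `M` and `L`. -/
noncomputable def thetaHom {ρ : CommLieRep 𝔽 L M} {A : M →ₗ[𝔽] M} {D : L →ₗ[𝔽] L}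
    (h : IsDerPair ρ A D) : csComplex ρ ⟶ csComplex ρ :=
  CochainComplex.ofHom
    (fun n => ModuleCat.ofHom ((theta A D n).restrict fun _ hf => theta_mem_CS A D hf :
      CS 𝔽 L M n →ₗ[𝔽] CS 𝔽 L M n))
    fun n => by
      rw [csComplex_d]
      ext f : 2
      exact Subtype.ext (h.theta_ce n _).symm

theorem ev_thetaHom {ρ : CommLieRep 𝔽 L M} {A : M →ₗ[𝔽] M} {D : L →ₗ[𝔽] L}
    (h : IsDerPair ρ A D) (n : ℕ) (f : (csComplex ρ).X n) :
    ev ρ n ((thetaHom h).f n f) = theta A D n (ev ρ n f) := rfl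

/-- By Cartan's formula, `L` acts trivially on its cohomology. -/
theorem homologyMap_lieDer (ρ : CommLieRep 𝔽 L M) (x : L) (n : ℕ)
    (h : IsDerPair ρ (ρ.act x) (lieBr 𝔽 x)) :
    HomologicalComplex.homologyMap (thetaHom h) n = 0 := by
  rw [← cancel_epi ((csComplex ρ).homologyπ n), HomologicalComplex.homologyπ_naturality,
    Limits.comp_zero]
  have hk : ∀ k, ce ρ n (ev ρ n ((csComplex ρ).iCycles n k)) = 0 := fun k => by
    rw [← ev_d, ← ModuleCat.comp_apply, HomologicalComplex.iCycles_d]; rfl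
  cases n with
  | zero =>
    suffices HomologicalComplex.cyclesMap (thetaHom h) 0 = 0 by rw [this, Limits.zero_comp]
    rw [← cancel_mono ((csComplex ρ).iCycles 0), HomologicalComplex.cyclesMap_i, Limits.zero_comp]
    ext k : 2
    refine ev_injective ρ 0 ?_
    have h1 := ins_ce_zero ρ (ev ρ 0 ((csComplex ρ).iCycles 0 k)) x
    rw [hk, map_zero] at h1
    exact h1.symm
  | succ n =>
    let ix : (csComplex ρ).X (n + 1) ⟶ (csComplex ρ).X n :=
      ModuleCat.ofHom ((ins x n).restrict fun f (hf : f ∈ CS 𝔽 L M (n + 1)) => ins_mem_CS hf x :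
        CS 𝔽 L M (n + 1) →ₗ[𝔽] CS 𝔽 L M n)
    suffices HomologicalComplex.cyclesMap (thetaHom h) (n + 1) =
        (csComplex ρ).iCycles (n + 1) ≫ ix ≫ (csComplex ρ).toCycles n (n + 1) by
      rw [this, Category.assoc, Category.assoc, HomologicalComplex.toCycles_comp_homologyπ,
        Limits.comp_zero, Limits.comp_zero]
    rw [← cancel_mono ((csComplex ρ).iCycles (n + 1)), HomologicalComplex.cyclesMap_i,
      Category.assoc, Category.assoc, HomologicalComplex.toCycles_i]
    ext k : 2
    refine ev_injective ρ (n + 1) ?_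
    have h1 := ins_ce_succ ρ n (ev ρ (n + 1) ((csComplex ρ).iCycles (n + 1) k)) x
    rw [hk, map_zero] at h1
    have h2 := add_self (𝔽 := 𝔽)
      (ce ρ n (ins x n (ev ρ (n + 1) ((csComplex ρ).iCycles (n + 1) k))))
    have h3 := add_right_cancel (h1.symm.trans h2.symm)
    have h4 := ev_d ρ n (ix ((csComplex ρ).iCycles (n + 1) k))
    exact Eq.trans h3 (Eq.symm h4)

end Cohomology

/-! ### The action of the quotient on the cohomology of the ideal -/

section Extension

universe u vh vg vq w

variable {𝔽 : Type u} {h : Type vh} {g : Type vg} {q : Type vq} {M : Type w} [Field 𝔽]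
  [AddCommGroup h] [Module 𝔽 h] [CommLieAlgebra 𝔽 h]
  [AddCommGroup g] [Module 𝔽 g] [CommLieAlgebra 𝔽 g]
  [AddCommGroup q] [Module 𝔽 q] [CommLieAlgebra 𝔽 q]
  [AddCommGroup M] [Module 𝔽 M]
  (e : CommLieExtension 𝔽 h g q) (ρ : CommLieRep 𝔽 g M)

/-- The restriction of a `g`-module to `h`. -/
def restrictRep : CommLieRep 𝔽 h M where
  act := ρ.act ∘ₗ e.incl
  act_bracket x y m := by simp [e.incl_bracket, ρ.act_bracket]

theorem bracket_mem_range (x : g) (y : h) :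
    lieBr 𝔽 x (e.incl y) ∈ LinearMap.range e.incl := by
  have : e.proj (lieBr 𝔽 x (e.incl y)) = 0 := by
    rw [e.proj_bracket, e.exact.apply_apply_eq_zero, map_zero]
  exact (e.exact _).1 this

/-- The adjoint action of `g` on the ideal `h`: `incl (adj x y) = [x, incl y]`. -/
noncomputable def adj : g →ₗ[𝔽] h →ₗ[𝔽] h :=
  LinearMap.mk₂ 𝔽
    (fun x y => (LinearEquiv.ofInjective e.incl e.incl_injective).symm
      ⟨lieBr 𝔽 x (e.incl y), bracket_mem_range e x y⟩)
    (fun x x' y => by rw [← map_add]; congr 1; ext; simp)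
    (fun c x y => by rw [← map_smul]; congr 1; ext; simp)
    (fun x y y' => by rw [← map_add]; congr 1; ext; simp)
    (fun c x y => by rw [← map_smul]; congr 1; ext; simp)

theorem incl_adj (x : g) (y : h) : e.incl (adj e x y) = lieBr 𝔽 x (e.incl y) := by
  have := LinearEquiv.apply_symm_apply (LinearEquiv.ofInjective e.incl e.incl_injective)
    ⟨lieBr 𝔽 x (e.incl y), bracket_mem_range e x y⟩
  exact congrArg Subtype.val this

theorem adj_incl (x : h) : adj e (e.incl x) = lieBr 𝔽 x := by
  ext y
  apply e.incl_injective
  rw [incl_adj, e.incl_bracket]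

variable [CharP 𝔽 2]

theorem isDerPair_adj (x : g) : IsDerPair (restrictRep e ρ) (ρ.act x) (adj e x) where
  der y z := by
    apply e.incl_injective
    simp only [incl_adj, e.incl_bracket, map_add]
    exact (isDerPair_lieDer ρ x).der _ _
  act y m := by
    have := (isDerPair_lieDer ρ x).act (e.incl y) m
    simp only [restrictRep, LinearMap.comp_apply, incl_adj]
    exact this

/-- The action of `g` on `HSⁿ(h, M)`, induced by
`(x · f)(y₁, …, yₙ) = x · f(y₁, …, yₙ) + ∑ᵢ f(y₁, …, [x, yᵢ], …, yₙ)` on cochains. -/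
noncomputable def actHS (n : ℕ) :
    g →ₗ[𝔽] HS (restrictRep e ρ) n →ₗ[𝔽] HS (restrictRep e ρ) n where
  toFun x := (HomologicalComplex.homologyMap (thetaHom (isDerPair_adj e ρ x)) n).hom
  map_add' x y := by
    rw [← ModuleCat.hom_add, ← HomologicalComplex.homologyMap_add]
    congr 2
    ext n f : 3
    refine ev_injective _ n ?_
    change theta (ρ.act (x + y)) (adj e (x + y)) n (ev _ n f) =
      theta (ρ.act x) (adj e x) n (ev _ n f) + theta (ρ.act y) (adj e y) n (ev _ n f)
    rw [map_add, map_add, theta_add]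
  map_smul' c x := by
    have : thetaHom (isDerPair_adj e ρ (c • x)) = c • thetaHom (isDerPair_adj e ρ x) := by
      ext n f : 3
      refine ev_injective _ n ?_
      change theta (ρ.act (c • x)) (adj e (c • x)) n (ev _ n f) =
        c • theta (ρ.act x) (adj e x) n (ev _ n f)
      rw [map_smul, map_smul, theta_smul]
    rw [this]
    exact congrArg ModuleCat.Hom.hom (ShortComplex.homologyMap_smul
      ((HomologicalComplex.shortComplexFunctor _ _ n).map (thetaHom (isDerPair_adj e ρ x))) c)

theorem actHS_incl (n : ℕ) (x : h) : actHS e ρ n (e.incl x) = 0 := by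
  have key : ∀ (D : h →ₗ[𝔽] h) (hD : D = lieBr 𝔽 x)
      (H : IsDerPair (restrictRep e ρ) ((restrictRep e ρ).act x) D),
      HomologicalComplex.homologyMap (thetaHom H) n = 0 := by
    rintro D rfl H
    exact homologyMap_lieDer _ x n H
  exact congrArg ModuleCat.Hom.hom (key _ (adj_incl e x) (isDerPair_adj e ρ (e.incl x)))

theorem actHS_bracket (n : ℕ) (x y : g) (a : HS (restrictRep e ρ) n) :
    actHS e ρ n (lieBr 𝔽 x y) a =
      actHS e ρ n x (actHS e ρ n y a) + actHS e ρ n y (actHS e ρ n x a) := by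
  have key : thetaHom (isDerPair_adj e ρ (lieBr 𝔽 x y)) =
      thetaHom (isDerPair_adj e ρ y) ≫ thetaHom (isDerPair_adj e ρ x) +
        thetaHom (isDerPair_adj e ρ x) ≫ thetaHom (isDerPair_adj e ρ y) := by
    ext n f : 3
    refine ev_injective _ n ?_
    change theta (ρ.act (lieBr 𝔽 x y)) (adj e (lieBr 𝔽 x y)) n (ev _ n f) =
      theta (ρ.act x) (adj e x) n (theta (ρ.act y) (adj e y) n (ev _ n f)) +
        theta (ρ.act y) (adj e y) n (theta (ρ.act x) (adj e x) n (ev _ n f))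
    rw [theta_comm]
    congr 2
    · ext m
      simp [ρ.act_bracket]
    · ext z
      apply e.incl_injective
      simp only [incl_adj, LinearMap.add_apply, LinearMap.comp_apply, map_add]
      have h1 := (isDerPair_lieDer ρ x).der y (e.incl z)
      have h2 := add_self (𝔽 := 𝔽) (lieBr 𝔽 y (lieBr 𝔽 x (e.incl z)))
      rw [h1]
      linear_combination (norm := module) -h2
  have h2 := congrArg (fun F => HomologicalComplex.homologyMap F n) key
  simp only [HomologicalComplex.homologyMap_add, HomologicalComplex.homologyMap_comp] at h2
  exact congrArg (fun F => F.hom a) h2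

/-- The `q`-module `HSⁿ(h, M)`: the class of `x ∈ g` in `q` acts as `x` does. -/
noncomputable def quotRep (n : ℕ) : CommLieRep 𝔽 q (HS (restrictRep e ρ) n) where
  act := (LinearMap.ker e.proj).liftQ (actHS e ρ n) (fun x hx => by
      obtain ⟨y, rfl⟩ := (e.exact x).1 hx
      exact actHS_incl e ρ n y) ∘ₗ
    (e.proj.quotKerEquivOfSurjective e.proj_surjective).symm.toLinearMap
  act_bracket x y a := by
    obtain ⟨x, rfl⟩ := e.proj_surjective x
    obtain ⟨y, rfl⟩ := e.proj_surjective y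
    have hs : ∀ z : g, (e.proj.quotKerEquivOfSurjective e.proj_surjective).symm (e.proj z) =
        (LinearMap.ker e.proj).mkQ z := fun z => by
      rw [LinearEquiv.symm_apply_eq]; rfl
    rw [← e.proj_bracket]
    simp only [LinearMap.comp_apply, LinearEquiv.coe_coe, hs,
      Submodule.mkQ_apply, Submodule.liftQ_apply]
    exact actHS_bracket e ρ n x y a

theorem quotRep_act_proj (n : ℕ) (x : g) : (quotRep e ρ n).act (e.proj x) = actHS e ρ n x := by
  have hs : (e.proj.quotKerEquivOfSurjective e.proj_surjective).symm (e.proj x) =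
      (LinearMap.ker e.proj).mkQ x := by
    rw [LinearEquiv.symm_apply_eq]; rfl
  simp only [quotRep, LinearMap.comp_apply, LinearEquiv.coe_coe, hs, Submodule.mkQ_apply,
    Submodule.liftQ_apply]

end Extension

/-! ### The spectral sequence of a filtered cochain complex -/

section Filtered

universe u w

variable {𝔽 : Type u} [Field 𝔽]

/-- `c` is a cocycle of degree `n` and `a` is its cohomology class. -/
def IsClassOf (K : CochainComplex (ModuleCat.{w} 𝔽) ℕ) (n : ℕ) (c : K.X n) (a : K.homology n) :
    Prop :=
  ∃ k : K.cycles n, K.iCycles n k = c ∧ K.homologyπ n k = a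

/-- A decreasing filtration of a cochain complex by subcomplexes. -/
structure Filtration (K : CochainComplex (ModuleCat.{w} 𝔽) ℕ) where
  F : ℤ → (n : ℕ) → Submodule 𝔽 (K.X n)
  anti : ∀ (p p' : ℤ) (n : ℕ), p ≤ p' → F p' n ≤ F p n
  d_mem : ∀ (p : ℤ) (n n' : ℕ) (c : K.X n), c ∈ F p n → K.d n n' c ∈ F p n'

namespace Filtration

variable {K : CochainComplex (ModuleCat.{w} 𝔽) ℕ} (Φ : Filtration K)

/-- `Z_r^p = {c ∈ Fᵖ | d c ∈ Fᵖ⁺ʳ}` in total degree `n`. -/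
def Z (r p : ℤ) (n : ℕ) : Submodule 𝔽 (K.X n) :=
  Φ.F p n ⊓ (Φ.F (p + r) (n + 1)).comap (K.d n (n + 1)).hom

/-- `Z_{r-1}^{p+1} + d Z_{r-1}^{p-r+1}` in total degree `n`. The components `K.d m n` of the
differential vanish unless `m + 1 = n`. -/
def B (r p : ℤ) (n : ℕ) : Submodule 𝔽 (K.X n) :=
  Φ.Z (r - 1) (p + 1) n ⊔ ⨆ m : ℕ, (Φ.Z (r - 1) (p - r + 1) m).map (K.d m n).hom

/-- `E_r^{p,n-p} = Z_r^p / (Z_{r-1}^{p+1} + d Z_{r-1}^{p-r+1})` in total degree `n`. -/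
abbrev E (r p : ℤ) (n : ℕ) : Type w :=
  Φ.Z r p n ⧸ (Φ.B r p n).submoduleOf (Φ.Z r p n)

/-- The class in `E_r` of an element of `Z_r^p`. -/
def toE (r p : ℤ) (n : ℕ) : Φ.Z r p n →ₗ[𝔽] Φ.E r p n :=
  ((Φ.B r p n).submoduleOf (Φ.Z r p n)).mkQ

theorem d_d_apply (n n' n'' : ℕ) (c : K.X n) : K.d n' n'' (K.d n n' c) = 0 := by
  rw [← ModuleCat.comp_apply, K.d_comp_d]; rfl

theorem d_mem_Z {r p p' : ℤ} (hp : p + r = p') (n n' : ℕ) (c : K.X n) (hc : c ∈ Φ.Z r p n) :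
    (K.d n n').hom c ∈ Φ.Z r p' n' := by
  subst hp
  by_cases h : n + 1 = n'
  · subst h
    refine ⟨hc.2, ?_⟩
    have : K.d (n + 1) (n + 1 + 1) (K.d n (n + 1) c) = 0 := d_d_apply ..
    exact Submodule.mem_comap.2 (this ▸ zero_mem _)
  · rw [K.shape n n' h]
    exact zero_mem _

theorem d_mem_B {r p p' : ℤ} (hp : p + r = p') (n n' : ℕ) (c : K.X n) (hc : c ∈ Φ.B r p n) :
    (K.d n n').hom c ∈ Φ.B r p' n' := by
  have hle : Φ.B r p n ≤ (Φ.B r p' n').comap (K.d n n').hom := by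
    refine sup_le (fun x hx => ?_) (iSup_le fun m => ?_)
    · refine Submodule.mem_sup_right (Submodule.mem_iSup_of_mem n ⟨x, ?_, rfl⟩)
      have : p' - r + 1 = p + 1 := by omega
      rw [this]
      exact hx
    · rintro _ ⟨x, -, rfl⟩
      have : K.d n n' (K.d m n x) = 0 := d_d_apply ..
      exact Submodule.mem_comap.2 (this ▸ zero_mem _)
  exact hle hc

/-- The differential of the `r`-th page, induced by the differential of the complex. -/
def dE {r p p' : ℤ} (hp : p + r = p') (n n' : ℕ) : Φ.E r p n →ₗ[𝔽] Φ.E r p' n' :=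
  Submodule.mapQ _ _ ((K.d n n').hom.restrict fun c hc => Φ.d_mem_Z hp n n' c hc)
    fun c hc => Φ.d_mem_B hp n n' c hc

open Classical in
/-- The `r`-th page of the spectral sequence of the filtration, in the first quadrant: its
differential is induced by `K.d` and has bidegree `(r, 1 - r)`. -/
noncomputable def page (r : ℤ) :
    HomologicalComplex (ModuleCat.{w} 𝔽) (ComplexShape.spectralSequenceNat (r, 1 - r)) where
  X pq := ModuleCat.of 𝔽 (Φ.E r pq.1 (pq.1 + pq.2))
  d pq pq' :=
    if h : (ComplexShape.spectralSequenceNat (r, 1 - r)).Rel pq pq' then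
      ModuleCat.ofHom (Φ.dE h.1 (pq.1 + pq.2) (pq'.1 + pq'.2))
    else 0
  shape pq pq' h := dif_neg h
  d_comp_d' i j k hij hjk := by
    rw [dif_pos hij, dif_pos hjk]
    refine ModuleCat.hom_ext (LinearMap.ext fun x => ?_)
    obtain ⟨z, rfl⟩ := Submodule.Quotient.mk_surjective _ x
    refine (Submodule.Quotient.mk_eq_zero _).2 ?_
    have : (K.d (j.1 + j.2) (k.1 + k.2)).hom ((K.d (i.1 + i.2) (j.1 + j.2)).hom z) = 0 :=
      d_d_apply ..
    refine Submodule.mem_comap.2 ?_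
    change (K.d (j.1 + j.2) (k.1 + k.2)).hom ((K.d (i.1 + i.2) (j.1 + j.2)).hom z) ∈
      Φ.B r k.1 (k.1 + k.2)
    rw [this]
    exact zero_mem _

/-- The class of `z ∈ Z_r^p` in position `(p, q)` of the `r`-th page. -/
noncomputable def toPage (r : ℤ) (pq : ℕ × ℕ) (z : Φ.Z r pq.1 (pq.1 + pq.2)) : (Φ.page r).X pq :=
  Φ.toE r pq.1 (pq.1 + pq.2) z

/-- The induced filtration of the cohomology: `Fᵖ Hⁿ` is the set of classes of cocycles in `Fᵖ`. -/
noncomputable def FH (p : ℤ) (n : ℕ) : Submodule 𝔽 (K.homology n) :=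
  ((Φ.F p n).comap (K.iCycles n).hom).map (K.homologyπ n).hom

/-- The graded piece `Fᵖ Hⁿ / Fᵖ⁺¹ Hⁿ`. -/
abbrev grH (p : ℤ) (n : ℕ) : Type w :=
  Φ.FH p n ⧸ (Φ.FH (p + 1) n).submoduleOf (Φ.FH p n)

end Filtration

end Filtered

/-! ### The filtration by the number of arguments in `h` -/

section HochschildSerre

universe u vh vg vq w

variable {𝔽 : Type u} {h : Type vh} {g : Type vg} {q : Type vq} {M : Type w} [Field 𝔽]
  [AddCommGroup h] [Module 𝔽 h] [CommLieAlgebra 𝔽 h]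
  [AddCommGroup g] [Module 𝔽 g] [CommLieAlgebra 𝔽 g]
  [AddCommGroup q] [Module 𝔽 q] [CommLieAlgebra 𝔽 q]
  [AddCommGroup M] [Module 𝔽 M]
  (e : CommLieExtension 𝔽 h g q) (ρ : CommLieRep 𝔽 g M)

/-- `f(x₁, …, xₙ) = 0` as soon as (at least) `n - p + 1` of the arguments `xᵢ` belong to `h`. -/
def VanishesOn (p : ℤ) (n : ℕ) (f : ML 𝔽 g M n) : Prop :=
  ∀ (x : Fin n → g) (S : Finset (Fin n)), (n : ℤ) - p + 1 ≤ S.card →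
    (∀ i ∈ S, x i ∈ LinearMap.range e.incl) → f x = 0

theorem VanishesOn.ce {p : ℤ} {n : ℕ} {f : ML 𝔽 g M n} (hf : VanishesOn e p n f) :
    VanishesOn e p (n + 1) (ce ρ n f) := by
  intro x S hS hx
  rw [ce_apply]
  -- at least `n - p + 1` arguments other than the `i`-th one lie in `h`
  have hcard : ∀ i : Fin (n + 1), (n : ℤ) - p + 1 ≤
      (Finset.univ.filter fun k : Fin n => i.succAbove k ∈ S).card := by
    intro i
    have h1 : S ⊆ insert i ((Finset.univ.filter fun k : Fin n => i.succAbove k ∈ S).map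
        i.succAboveEmb) := by
      intro k hk
      by_cases hki : k = i
      · simp [hki]
      · obtain ⟨k', rfl⟩ := Fin.exists_succAbove_eq hki
        simp [hk]
    have h2 := (Finset.card_le_card h1).trans (Finset.card_insert_le _ _)
    rw [Finset.card_map] at h2
    push_cast at hS
    omega
  have h1 : ∀ i : Fin (n + 1), f (i.removeNth x) = 0 := fun i =>
    hf _ _ (hcard i) fun k hk => hx _ (Finset.mem_filter.1 hk).2
  have h2 : ∀ (i : Fin (n + 1)) (j : Fin n),
      f (Function.update (i.removeNth x) j (lieBr 𝔽 (x i) (x (i.succAbove j)))) = 0 := by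
    intro i j
    refine hf _ _ (hcard i) fun k hk => ?_
    have hk' := hx _ (Finset.mem_filter.1 hk).2
    by_cases hkj : k = j
    · subst hkj
      obtain ⟨y, hy⟩ := hk'
      rw [Function.update_self, ← hy]
      exact bracket_mem_range e _ y
    · rw [Function.update_of_ne hkj]
      exact hk'
  simp [ceSum, h1, h2]

variable [CharP 𝔽 2]

/-- The filtration `Fᵖ CSⁿ(g, M)` of the cochains by the number of arguments in `h`. -/
noncomputable def hsFiltration : Filtration (csComplex ρ) where
  F p n :=
    { carrier := {f | VanishesOn e p n (ev ρ n f)}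
      add_mem' := fun hf hf' x S hS hx => by
        rw [map_add, add_apply, hf x S hS hx, hf' x S hS hx, add_zero]
      zero_mem' := fun x S hS hx => by rw [map_zero]; rfl
      smul_mem' := fun c f hf x S hS hx => by
        rw [map_smul, smul_apply, hf x S hS hx, smul_zero] }
  anti p p' n hpp' f hf x S hS hx := hf x S (by omega) hx
  d_mem p n n' f hf := by
    by_cases hn : n + 1 = n'
    · subst hn
      change VanishesOn e p (n + 1) (ev ρ (n + 1) _)
      rw [ev_d]
      exact VanishesOn.ce e ρ hf
    · rw [(csComplex ρ).shape n n' hn]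
      exact zero_mem _

/-- For `f ∈ CSᵖ⁺ᵠ(g, M)` and a cochain `φ ∈ CSᵖ(q, HSᵠ(h, M))`: for all `x₁, …, xₚ ∈ g`, the map
`(y₁, …, y_q) ↦ f(x₁, …, xₚ, y₁, …, y_q)` on `h` is a cocycle in `CSᵠ(h, M)`, and `φ` sends the
images of `x₁, …, xₚ` in `q` to its class. -/
def IsInducedCochain (p n : ℕ) (f : (csComplex ρ).X (p + n))
    (φ : (csComplex (quotRep e ρ n)).X p) : Prop :=
  ∀ x : Fin p → g, ∃ c : (csComplex (restrictRep e ρ)).X n,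
    (∀ y : Fin n → h, ev _ n c y = ev ρ (p + n) f (Fin.append x (e.incl ∘ y))) ∧
    IsClassOf (csComplex (restrictRep e ρ)) n c (ev _ p φ (e.proj ∘ x))

end HochschildSerre

end CommLie

universe u vh vg vq w

/-!
The differential of `g` splits along the extension. If the last `n` arguments of a cochain `f` on
`g` are restricted to `h`, one obtains a cochain on `g` with values in the cochains of `h`, and `df`
becomes the sum of the differential over `g` with these coefficients and of the differential of `h`
applied to the values. Hence `f ∈ Z₁` means that the restriction of `f` takes values in cocycles;
these depend on the first arguments only through their images in `q`, and on their classes `d` is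
the differential of `q` with coefficients in `HSⁿ(h, M)`.

This identifies the second page. For surjectivity, a symmetric family of cochains of `h` indexed by
`q` extends to a symmetric cochain on `g` by summing over shuffles, by means of a linear retraction
`g → h`. For injectivity, a family of coboundaries of `h` has primitives that depend linearly, hence
multilinearly, on the arguments in `q`; subtracting the differential of their shuffle extension
moves `f` one step further in the filtration. Convergence only uses that the filtration is bounded
in each degree.
-/

namespace CommLie

/-! ### Classes in the homology of a complex of modules -/

section Homology

variable {R : Type*} [Ring R] {ι : Type*} {c : ComplexShape ι}
  (K : HomologicalComplex (ModuleCat R) c)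

theorem exists_lift_cycles {V : Type*} [AddCommGroup V] [Module R V] {i j : ι}
    (hj : c.next i = j) (f : V →ₗ[R] K.X i) (hf : ∀ v, K.d i j (f v) = 0) :
    ∃ f' : V →ₗ[R] K.cycles i, ∀ v, K.iCycles i (f' v) = f v := by
  subst hj
  refine ⟨(K.sc i).moduleCatCyclesIso.inv.hom ∘ₗ
    f.codRestrict (LinearMap.ker (K.sc i).g.hom) hf, fun v => ?_⟩
  exact congrArg (fun F => F.hom ⟨f v, hf v⟩) (K.sc i).moduleCatCyclesIso_inv_iCycles

theorem d_iCycles_apply (i j : ι) (k : K.cycles i) : K.d i j (K.iCycles i k) = 0 := by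
  rw [← ModuleCat.comp_apply, HomologicalComplex.iCycles_d]; rfl

theorem iCycles_injective (i : ι) : Function.Injective (K.iCycles i) :=
  (ModuleCat.mono_iff_injective _).1 inferInstance

theorem homologyπ_surjective (i : ι) : Function.Surjective (K.homologyπ i) :=
  (ModuleCat.epi_iff_surjective _).1 inferInstance

theorem homologyπ_eq_zero_iff {j : ι} (k : K.cycles j) :
    K.homologyπ j k = 0 ↔ ∃ (i : ι) (x : K.X i), K.d i j x = K.iCycles j k := by
  constructor
  · intro h
    have hex : (ShortComplex.mk (K.toCycles (c.prev j) j) (K.homologyπ j) (by simp)).Exact :=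
      ShortComplex.exact_of_g_is_cokernel _ (K.homologyIsCokernel _ j rfl)
    obtain ⟨x, hx⟩ := (ShortComplex.moduleCat_exact_iff _).1 hex k h
    refine ⟨_, x, ?_⟩
    rw [← K.toCycles_i (c.prev j) j, ModuleCat.comp_apply]
    exact congrArg _ hx
  · rintro ⟨i, x, hx⟩
    have : K.toCycles i j x = k := by
      apply iCycles_injective
      rw [← ModuleCat.comp_apply, K.toCycles_i, hx]
    rw [← this, ← ModuleCat.comp_apply, K.toCycles_comp_homologyπ]
    rfl

end Homology

theorem exists_mem_d_pred_eq {R : Type*} [Ring R] {K : CochainComplex (ModuleCat R) ℕ}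
    (S : ∀ n, Submodule R (K.X n)) {m n : ℕ} {b : K.X m} (hb : b ∈ S m) :
    ∃ b' ∈ S (n - 1), K.d (n - 1) n b' = K.d m n b := by
  by_cases h : m + 1 = n
  · subst h
    exact ⟨b, hb, rfl⟩
  · exact ⟨0, zero_mem _, by rw [K.shape m n h, map_zero]; rfl⟩

section Classes

variable {𝔽 : Type u} [Field 𝔽] {K : CochainComplex (ModuleCat.{w} 𝔽) ℕ}

theorem IsClassOf.d_eq_zero {n : ℕ} {c : K.X n} {a : K.homology n} (h : IsClassOf K n c a)
    (m : ℕ) : K.d n m c = 0 := by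
  obtain ⟨k, rfl, -⟩ := h
  exact d_iCycles_apply K n m k

theorem exists_linear_isClassOf {V : Type*} [AddCommGroup V] [Module 𝔽 V] {n : ℕ}
    (f : V →ₗ[𝔽] K.X n) (hf : ∀ v, K.d n (n + 1) (f v) = 0) :
    ∃ χ : V →ₗ[𝔽] K.homology n, ∀ v, IsClassOf K n (f v) (χ v) := by
  obtain ⟨f', hf'⟩ := exists_lift_cycles K (by simp) f hf
  exact ⟨(K.homologyπ n).hom ∘ₗ f', fun v => ⟨f' v, hf' v, rfl⟩⟩

theorem exists_isClassOf {n : ℕ} {c : K.X n} (h : K.d n (n + 1) c = 0) :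
    ∃ a, IsClassOf K n c a := by
  obtain ⟨χ, hχ⟩ := exists_linear_isClassOf (LinearMap.ker (K.d n (n + 1)).hom).subtype
    fun v => v.2
  exact ⟨_, hχ ⟨c, h⟩⟩

theorem isClassOf_surjective {n : ℕ} (a : K.homology n) : ∃ c, IsClassOf K n c a := by
  obtain ⟨k, hk⟩ := homologyπ_surjective K n a
  exact ⟨_, k, rfl, hk⟩

theorem IsClassOf.sub {n : ℕ} {c c' : K.X n} {a a' : K.homology n} (h : IsClassOf K n c a)
    (h' : IsClassOf K n c' a') : IsClassOf K n (c - c') (a - a') := by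
  obtain ⟨k, rfl, rfl⟩ := h
  obtain ⟨k', rfl, rfl⟩ := h'
  exact ⟨k - k', map_sub _ _ _, map_sub _ _ _⟩

theorem IsClassOf.eq_zero_iff {n : ℕ} {c : K.X n} {a : K.homology n} (h : IsClassOf K n c a) :
    a = 0 ↔ ∃ b, K.d (n - 1) n b = c := by
  obtain ⟨k, rfl, rfl⟩ := h
  refine (homologyπ_eq_zero_iff K k).trans ⟨fun ⟨m, b, hb⟩ => ?_, fun ⟨b, hb⟩ => ⟨_, b, hb⟩⟩
  obtain ⟨b', -, hb'⟩ := exists_mem_d_pred_eq (fun _ => ⊤) (n := n) (Submodule.mem_top (x := b))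
  exact ⟨b', hb'.trans hb⟩

theorem IsClassOf.unique {n : ℕ} {c : K.X n} {a a' : K.homology n} (h : IsClassOf K n c a)
    (h' : IsClassOf K n c a') : a = a' := by
  obtain ⟨k, rfl, rfl⟩ := h
  obtain ⟨k', hk, rfl⟩ := h'
  rw [iCycles_injective K n hk]

end Classes

theorem exists_quotient_equiv {R V W : Type*} [Ring R] [AddCommGroup V] [Module R V]
    [AddCommGroup W] [Module R W] (p : Submodule R V) (f : V →ₗ[R] W)
    (hf : Function.Surjective f) (hker : ∀ v, f v = 0 ↔ v ∈ p) :
    ∃ ε : (V ⧸ p) ≃ₗ[R] W, ∀ v, ε (Submodule.Quotient.mk v) = f v := by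
  obtain rfl : LinearMap.ker f = p := Submodule.ext hker
  exact ⟨f.quotKerEquivOfSurjective hf, fun _ => rfl⟩

/-! ### The spectral sequence of a filtered complex -/

namespace Filtration

variable {𝔽 : Type u} [Field 𝔽] {K : CochainComplex (ModuleCat.{w} 𝔽) ℕ} (Φ : Filtration K)

theorem mem_Z {r p : ℤ} {n : ℕ} {c : K.X n} :
    c ∈ Φ.Z r p n ↔ c ∈ Φ.F p n ∧ K.d n (n + 1) c ∈ Φ.F (p + r) (n + 1) := Iff.rfl

theorem mem_Z_of_d_eq_zero {p : ℤ} {n : ℕ} {c : K.X n} (hc : c ∈ Φ.F p n)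
    (hd : K.d n (n + 1) c = 0) (r : ℤ) : c ∈ Φ.Z r p n :=
  Φ.mem_Z.2 ⟨hc, hd ▸ zero_mem _⟩

theorem Z_mono {r r' p p' : ℤ} (hp : p' ≤ p) (hr : p' + r' ≤ p + r) (n : ℕ) :
    Φ.Z r p n ≤ Φ.Z r' p' n :=
  fun _ hc => ⟨Φ.anti _ _ _ hp hc.1, Φ.anti _ _ _ hr hc.2⟩

theorem d_mem_F {r p p' : ℤ} {n n' : ℕ} (hn : n + 1 = n') (hp : p + r = p') {c : K.X n}
    (hc : c ∈ Φ.Z r p n) : K.d n n' c ∈ Φ.F p' n' := by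
  subst hn hp
  exact hc.2

theorem mem_B {r p : ℤ} {n : ℕ} {c : K.X n} :
    c ∈ Φ.B r p n ↔ ∃ a ∈ Φ.Z (r - 1) (p + 1) n,
      ∃ b ∈ Φ.Z (r - 1) (p - r + 1) (n - 1), c = a + K.d (n - 1) n b := by
  have hpred : ⨆ m, (Φ.Z (r - 1) (p - r + 1) m).map (K.d m n).hom =
      (Φ.Z (r - 1) (p - r + 1) (n - 1)).map (K.d (n - 1) n).hom := by
    refine le_antisymm (iSup_le fun m => ?_) (le_iSup_of_le (n - 1) le_rfl)
    rintro _ ⟨b, hb, rfl⟩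
    exact exists_mem_d_pred_eq (Φ.Z (r - 1) (p - r + 1)) hb
  rw [B, hpred, Submodule.mem_sup]
  constructor
  · rintro ⟨a, ha, _, ⟨b, hb, rfl⟩, rfl⟩
    exact ⟨a, ha, b, hb, rfl⟩
  · rintro ⟨a, ha, b, hb, rfl⟩
    exact ⟨a, ha, _, ⟨b, hb, rfl⟩, rfl⟩

theorem Z_le_B (r p : ℤ) (n : ℕ) : Φ.Z (r - 1) (p + 1) n ≤ Φ.B r p n := le_sup_left

theorem d_mem_B_of_mem_Z {r p : ℤ} {m : ℕ} (n : ℕ) {b : K.X m}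
    (hb : b ∈ Φ.Z (r - 1) (p - r + 1) m) : K.d m n b ∈ Φ.B r p n :=
  Submodule.mem_sup_right (Submodule.mem_iSup_of_mem m ⟨b, hb, rfl⟩)

theorem toPage_surjective (r : ℤ) (pq : ℕ × ℕ) : Function.Surjective (Φ.toPage r pq) :=
  Submodule.Quotient.mk_surjective _

theorem toPage_eq_zero_iff (r : ℤ) (pq : ℕ × ℕ) (z : Φ.Z r pq.1 (pq.1 + pq.2)) :
    Φ.toPage r pq z = 0 ↔ (z : K.X (pq.1 + pq.2)) ∈ Φ.B r pq.1 (pq.1 + pq.2) :=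
  Submodule.Quotient.mk_eq_zero _

theorem toPage_eq_iff (r : ℤ) (pq : ℕ × ℕ) (z z' : Φ.Z r pq.1 (pq.1 + pq.2)) :
    Φ.toPage r pq z = Φ.toPage r pq z' ↔
      (z - z' : K.X (pq.1 + pq.2)) ∈ Φ.B r pq.1 (pq.1 + pq.2) :=
  Submodule.Quotient.eq _

theorem page_d_toPage (r : ℤ) {pq pq' : ℕ × ℕ}
    (h : (ComplexShape.spectralSequenceNat (r, 1 - r)).Rel pq pq')
    (z : Φ.Z r pq.1 (pq.1 + pq.2)) :
    (Φ.page r).d pq pq' (Φ.toPage r pq z) = Φ.toPage r pq'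
      ⟨K.d (pq.1 + pq.2) (pq'.1 + pq'.2) z, Φ.d_mem_Z h.1 _ _ _ z.2⟩ := by
  have : (Φ.page r).d pq pq' = ModuleCat.ofHom (Φ.dE h.1 (pq.1 + pq.2) (pq'.1 + pq'.2)) :=
    dif_pos h
  rw [this]
  rfl

theorem page_d_eq_zero {r : ℤ} {pq : ℕ × ℕ} (z : Φ.Z r pq.1 (pq.1 + pq.2))
    (hz : (z : K.X (pq.1 + pq.2)) ∈ Φ.Z (r + 1) pq.1 (pq.1 + pq.2))
    (pq' : ℕ × ℕ) : (Φ.page r).d pq pq' (Φ.toPage r pq z) = 0 := by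
  by_cases h : (ComplexShape.spectralSequenceNat (r, 1 - r)).Rel pq pq'
  · have hfst : (pq.1 : ℤ) + (r + 1) = pq'.1 + 1 := by have := h.1; simp only at this; omega
    have hdeg : pq.1 + pq.2 + 1 = pq'.1 + pq'.2 := by
      have := h.1; have := h.2; simp only at *; omega
    rw [page_d_toPage Φ r h, toPage_eq_zero_iff]
    exact Φ.Z_le_B _ _ _ (Φ.mem_Z_of_d_eq_zero (Φ.d_mem_F hdeg hfst hz) (d_d_apply ..) _)
  · rw [(Φ.page r).shape _ _ h]
    rfl

theorem exists_sub_mem_Z {r p : ℤ} {n n' : ℕ} (hn : n + 1 = n') {z : K.X n} (hz : z ∈ Φ.Z r p n)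
    (hd : K.d n n' z ∈ Φ.B r (p + r) n') : ∃ y ∈ Φ.B r p n, z - y ∈ Φ.Z (r + 1) p n := by
  subst hn
  obtain ⟨a, ha, b, hb, hab⟩ := Φ.mem_B.1 hd
  rw [add_sub_cancel_right] at hb
  refine ⟨b, Φ.Z_le_B _ _ _ hb, Φ.mem_Z.2 ⟨sub_mem hz.1 (Φ.anti _ _ _ (by omega) hb.1), ?_⟩⟩
  have hab' : K.d n (n + 1) z = a + K.d n (n + 1) b := hab
  rw [map_sub, hab', add_sub_cancel_right]
  exact Φ.anti _ _ _ (by omega) ha.1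

theorem B_le_sup_B_succ (r p : ℤ) (n : ℕ) :
    Φ.B r p n ≤ Φ.Z (r - 1) (p + 1) n ⊔ Φ.B (r + 1) p n := by
  intro c hc
  obtain ⟨a, ha, b, hb, rfl⟩ := Φ.mem_B.1 hc
  exact add_mem (Submodule.mem_sup_left ha) (Submodule.mem_sup_right
    (Φ.d_mem_B_of_mem_Z n (Φ.Z_mono (by omega) (by omega) _ hb)))

theorem d_mem_F_of_mem_B {r p : ℤ} {n : ℕ} {c : K.X n} (hc : c ∈ Φ.B r p n) :
    K.d n (n + 1) c ∈ Φ.F (p + r) (n + 1) := by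
  obtain ⟨a, ha, b, -, rfl⟩ := Φ.mem_B.1 hc
  rw [map_add, d_d_apply, add_zero]
  exact Φ.d_mem_F rfl (by ring) ha

theorem mem_B_succ {r p : ℤ} {m n : ℕ} {z : K.X n} (hz : z ∈ Φ.Z (r + 1) p n) {y : K.X m}
    (hy : y ∈ Φ.Z r (p - r) m) (hzy : K.d m n y - z ∈ Φ.B r p n) : z ∈ Φ.B (r + 1) p n := by
  have hdy : K.d m n y ∈ Φ.B (r + 1) p n :=
    Φ.d_mem_B_of_mem_Z n (Φ.Z_mono (by omega) (by omega) _ hy)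
  obtain ⟨a, ha, b, hb, hab⟩ := Submodule.mem_sup.1 (Φ.B_le_sup_B_succ r p n hzy)
  have hda : K.d n (n + 1) a ∈ Φ.F (p + (r + 1)) (n + 1) := by
    rw [eq_sub_of_add_eq hab, map_sub, map_sub, d_d_apply, zero_sub]
    exact sub_mem (neg_mem hz.2) (Φ.d_mem_F_of_mem_B hb)
  have haB : a ∈ Φ.B (r + 1) p n :=
    Φ.Z_le_B _ _ _ (Φ.mem_Z.2 ⟨ha.1, Φ.anti _ _ _ (by omega) hda⟩)
  have hz' : z = K.d m n y - (a + b) := by rw [hab, sub_sub_cancel]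
  exact hz' ▸ sub_mem hdy (add_mem haB hb)

theorem mem_B_succ_of_page_d_eq {r : ℤ} {pq i : ℕ × ℕ} {x : (Φ.page r).X i}
    (z : Φ.Z r pq.1 (pq.1 + pq.2)) (hz : (z : K.X (pq.1 + pq.2)) ∈ Φ.Z (r + 1) pq.1 (pq.1 + pq.2))
    (hx : (Φ.page r).d i pq x = Φ.toPage r pq z) :
    (z : K.X (pq.1 + pq.2)) ∈ Φ.B (r + 1) pq.1 (pq.1 + pq.2) := by
  obtain ⟨y, rfl⟩ := Φ.toPage_surjective r i x
  by_cases h : (ComplexShape.spectralSequenceNat (r, 1 - r)).Rel i pq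
  · rw [page_d_toPage Φ r h, toPage_eq_iff] at hx
    have hfst : (pq.1 : ℤ) - r = i.1 := by have := h.1; simp only at this; omega
    exact Φ.mem_B_succ hz (y := (y : K.X (i.1 + i.2))) (by rw [hfst]; exact y.2) hx
  · rw [(Φ.page r).shape _ _ h] at hx
    refine Φ.mem_B_succ hz (zero_mem (Φ.Z r (pq.1 - r) 0)) ?_
    rw [map_zero, zero_sub]
    exact neg_mem ((Φ.toPage_eq_zero_iff r pq z).1 hx.symm)

/-- A filtration of first quadrant type: `Fᵖ Kⁿ` is everything for `p ≤ 0` and zero for `p > n`. -/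
structure IsFirstQuadrant : Prop where
  eq_top : ∀ (p : ℤ) (n : ℕ), p ≤ 0 → Φ.F p n = ⊤
  eq_bot : ∀ (p : ℤ) (n : ℕ), (n : ℤ) < p → Φ.F p n = ⊥

variable {Φ}

namespace IsFirstQuadrant

theorem mem_F (hΦ : Φ.IsFirstQuadrant) {p : ℤ} (hp : p ≤ 0) {n : ℕ} (c : K.X n) : c ∈ Φ.F p n := by
  rw [hΦ.eq_top p n hp]
  trivial

theorem eq_zero_of_mem_F (hΦ : Φ.IsFirstQuadrant) {p : ℤ} {n : ℕ} (hn : (n : ℤ) < p) {c : K.X n}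
    (hc : c ∈ Φ.F p n) : c = 0 := by
  rwa [hΦ.eq_bot p n hn, Submodule.mem_bot] at hc

theorem d_eq_zero_of_mem_Z (hΦ : Φ.IsFirstQuadrant) {r p : ℤ} {n : ℕ} (hn : (n : ℤ) + 1 < p + r)
    {z : K.X n} (hz : z ∈ Φ.Z r p n) : K.d n (n + 1) z = 0 :=
  hΦ.eq_zero_of_mem_F (by push_cast; exact hn) hz.2

theorem exists_toPage_eq_of_cycle (hΦ : Φ.IsFirstQuadrant) {r : ℤ} (hr : 0 ≤ r)
    {pq : ℕ × ℕ} (x : (Φ.page r).X pq) (hx : ∀ pq', (Φ.page r).d pq pq' x = 0) :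
    ∃ z : Φ.Z r pq.1 (pq.1 + pq.2),
      (z : K.X (pq.1 + pq.2)) ∈ Φ.Z (r + 1) pq.1 (pq.1 + pq.2) ∧ Φ.toPage r pq z = x := by
  obtain ⟨z, rfl⟩ := Φ.toPage_surjective r pq x
  by_cases h : r ≤ pq.2 + 1
  · lift r to ℕ using hr
    have hrel : (ComplexShape.spectralSequenceNat ((r : ℤ), 1 - (r : ℤ))).Rel pq
        (pq.1 + r, pq.2 + 1 - r) := by
      constructor <;> simp only <;> omega
    have hdz := hx (pq.1 + r, pq.2 + 1 - r)
    rw [page_d_toPage Φ r hrel, toPage_eq_zero_iff] at hdz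
    obtain ⟨y, hy, hzy⟩ := Φ.exists_sub_mem_Z (n' := pq.1 + r + (pq.2 + 1 - r)) (by omega) z.2
      (by push_cast at hdz; exact hdz)
    refine ⟨⟨z - y, Φ.Z_mono le_rfl (by omega) _ hzy⟩, hzy, ?_⟩
    rw [toPage_eq_iff, sub_sub_cancel_left]
    exact neg_mem hy
  · have hdz := hΦ.d_eq_zero_of_mem_Z (by push_cast; omega) z.2
    exact ⟨z, Φ.mem_Z_of_d_eq_zero z.2.1 hdz _, rfl⟩

-- If `(p - r, q + r - 1)` is not in the first quadrant, then `p < r`, and `b` contributes to `B r`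
-- because `F` is everything in filtration degrees at most `0`, or `q + r < 1`, and `b = 0`.
theorem exists_rel_or_d_mem_B (hΦ : Φ.IsFirstQuadrant) {r : ℤ} (hr : 0 ≤ r) (pq : ℕ × ℕ) {m : ℕ}
    {b : K.X m} (hb : b ∈ Φ.Z r (pq.1 - r) m) :
    (∃ i : ℕ × ℕ, (ComplexShape.spectralSequenceNat (r, 1 - r)).Rel i pq ∧ m = i.1 + i.2) ∨
      K.d m (pq.1 + pq.2) b ∈ Φ.B r pq.1 (pq.1 + pq.2) := by
  by_cases hm : m + 1 = pq.1 + pq.2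
  · by_cases hp : (pq.1 : ℤ) < r
    · exact .inr (Φ.d_mem_B_of_mem_Z _ (Φ.mem_Z.2
        ⟨hΦ.mem_F (by omega) b, Φ.anti _ _ _ (by omega) (Φ.d_mem_F rfl rfl hb)⟩))
    · by_cases hq : (pq.2 : ℤ) + r < 1
      · rw [hΦ.eq_zero_of_mem_F (by omega) hb.1, map_zero]
        exact .inr (zero_mem _)
      · lift r to ℕ using hr
        refine .inl ⟨(pq.1 - r, pq.2 + r - 1), ⟨?_, ?_⟩, ?_⟩ <;> simp only <;> omega
  · rw [K.shape _ _ hm]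
    exact .inr (zero_mem _)

theorem exists_page_d_eq (hΦ : Φ.IsFirstQuadrant) {r : ℤ} (hr : 0 ≤ r) {pq : ℕ × ℕ}
    (z : Φ.Z r pq.1 (pq.1 + pq.2))
    (hz : (z : K.X (pq.1 + pq.2)) ∈ Φ.B (r + 1) pq.1 (pq.1 + pq.2)) :
    ∃ (i : ℕ × ℕ) (x : (Φ.page r).X i), (Φ.page r).d i pq x = Φ.toPage r pq z := by
  obtain ⟨a, ha, b, hb, hab⟩ := Φ.mem_B.1 hz
  have haB : a ∈ Φ.B r pq.1 (pq.1 + pq.2) := Φ.Z_le_B _ _ _ (Φ.Z_mono le_rfl (by omega) _ ha)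
  replace hb := Φ.Z_mono (r' := r) (p' := pq.1 - r) (by omega) (by omega) _ hb
  obtain ⟨i, hrel, hi⟩ | hB := hΦ.exists_rel_or_d_mem_B hr pq hb
  · have hfst : (pq.1 : ℤ) - r = i.1 := by have := hrel.1; simp only at this; omega
    generalize pq.1 + pq.2 - 1 = m at b hi
    subst hi
    refine ⟨i, Φ.toPage r i ⟨b, hfst ▸ hb⟩, ?_⟩
    rw [page_d_toPage Φ r hrel, toPage_eq_iff, hab, sub_add_cancel_right]
    exact neg_mem haB
  · refine ⟨pq, 0, ?_⟩
    rw [map_zero]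
    exact ((Φ.toPage_eq_zero_iff r pq z).2 (hab ▸ add_mem haB hB)).symm

theorem exists_homology_iso (hΦ : Φ.IsFirstQuadrant) {r : ℤ} (hr : 0 ≤ r)
    (pq : ℕ × ℕ) : ∃ ε : (Φ.page r).homology pq ≃ₗ[𝔽] (Φ.page (r + 1)).X pq,
      ∀ (z : K.X (pq.1 + pq.2)) (hz : z ∈ Φ.Z r pq.1 (pq.1 + pq.2))
        (hz' : z ∈ Φ.Z (r + 1) pq.1 (pq.1 + pq.2)) (k : (Φ.page r).cycles pq),
        (Φ.page r).iCycles pq k = Φ.toPage r pq ⟨z, hz⟩ →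
          ε ((Φ.page r).homologyπ pq k) = Φ.toPage (r + 1) pq ⟨z, hz'⟩ := by
  have hle : Φ.Z (r + 1) pq.1 (pq.1 + pq.2) ≤ Φ.Z r pq.1 (pq.1 + pq.2) :=
    Φ.Z_mono le_rfl (by omega) _
  obtain ⟨ψ, hψ⟩ := exists_lift_cycles (Φ.page r) rfl
    (Φ.toE r pq.1 (pq.1 + pq.2) ∘ₗ Submodule.inclusion hle)
    (fun z => Φ.page_d_eq_zero (Submodule.inclusion hle z) z.2 _)
  have hsurj : Function.Surjective (((Φ.page r).homologyπ pq).hom ∘ₗ ψ) := by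
    refine (homologyπ_surjective _ _).comp fun k => ?_
    obtain ⟨z, hz, hzk⟩ := hΦ.exists_toPage_eq_of_cycle hr ((Φ.page r).iCycles pq k)
      fun pq' => d_iCycles_apply _ _ _ _
    exact ⟨⟨z, hz⟩, iCycles_injective _ _ ((hψ _).trans hzk)⟩
  have hker (z : Φ.Z (r + 1) pq.1 (pq.1 + pq.2)) :
      (Φ.page r).homologyπ pq (ψ z) = 0 ↔
        (z : K.X (pq.1 + pq.2)) ∈ Φ.B (r + 1) pq.1 (pq.1 + pq.2) := by
    rw [homologyπ_eq_zero_iff, hψ]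
    exact ⟨fun ⟨_, _, hx⟩ => Φ.mem_B_succ_of_page_d_eq ⟨z, hle z.2⟩ z.2 hx,
      hΦ.exists_page_d_eq hr ⟨z, hle z.2⟩⟩
  obtain ⟨ε, hε⟩ := exists_quotient_equiv ((Φ.B (r + 1) pq.1 _).submoduleOf _) _ hsurj hker
  refine ⟨ε.symm, fun z hz hz' k hk => (LinearEquiv.symm_apply_eq ε).2 ?_⟩
  have : k = ψ ⟨z, hz'⟩ := iCycles_injective _ _ (hk.trans (Eq.symm (hψ ⟨z, hz'⟩)))
  exact (congrArg _ this).trans (hε ⟨z, hz'⟩).symm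

/-- The spectral sequence of a filtration of first quadrant type. The isomorphisms between pages are
those of `exists_homology_iso`, which are the identity on representatives. -/
noncomputable def spectralSequence (hΦ : Φ.IsFirstQuadrant) :
    CohomologicalSpectralSequenceNat (ModuleCat.{w} 𝔽) 0 where
  page r _ := Φ.page r
  iso r r' pq hrr' hr := (hΦ.exists_homology_iso hr pq).choose.toModuleIso ≪≫
    eqToIso (by rw [hrr'])

end IsFirstQuadrant

theorem mem_FH {p : ℤ} {n : ℕ} {a : K.homology n} :
    a ∈ Φ.FH p n ↔ ∃ c ∈ Φ.F p n, IsClassOf K n c a := by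
  constructor
  · rintro ⟨k, hk, rfl⟩
    exact ⟨_, hk, k, rfl, rfl⟩
  · rintro ⟨c, hc, k, rfl, rfl⟩
    exact ⟨k, hc, rfl⟩

namespace IsFirstQuadrant

theorem FH_zero (hΦ : Φ.IsFirstQuadrant) (n : ℕ) : Φ.FH 0 n = ⊤ := by
  refine eq_top_iff.2 fun a _ => mem_FH.2 ?_
  obtain ⟨c, hc⟩ := isClassOf_surjective a
  exact ⟨c, hΦ.mem_F le_rfl c, hc⟩

theorem FH_succ (hΦ : Φ.IsFirstQuadrant) (n : ℕ) : Φ.FH (n + 1) n = ⊥ := by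
  refine eq_bot_iff.2 fun a ha => ?_
  obtain ⟨c, hc, hca⟩ := mem_FH.1 ha
  exact hca.eq_zero_iff.2 ⟨0, by rw [hΦ.eq_zero_of_mem_F (by omega) hc, map_zero]⟩

theorem mem_FH_succ_iff (hΦ : Φ.IsFirstQuadrant) {r p : ℤ} {n : ℕ} (hp : p < r)
    (hn : (n : ℤ) + 1 < p + r) {z : K.X n} (hz : z ∈ Φ.Z r p n) {α : K.homology n}
    (hα : IsClassOf K n z α) : α ∈ Φ.FH (p + 1) n ↔ z ∈ Φ.B r p n := by
  rw [mem_FH]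
  constructor
  · rintro ⟨c, hc, hcα⟩
    obtain ⟨b, hb⟩ := (hα.sub hcα).eq_zero_iff.1 (sub_self α)
    have hcB := Φ.Z_le_B _ _ _ (Φ.mem_Z_of_d_eq_zero hc (hcα.d_eq_zero _) (r - 1))
    rw [← sub_add_cancel z c, ← hb]
    refine add_mem ?_ hcB
    rcases n with _ | n
    · rw [K.shape (0 - 1) 0 (by simp)]
      exact zero_mem _
    · refine Φ.d_mem_B_of_mem_Z _ (Φ.mem_Z.2 ⟨hΦ.mem_F (by omega) b, ?_⟩)
      have hdb : K.d n (n + 1) b = z - c := hb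
      change K.d n (n + 1) b ∈ _
      rw [hdb, show p - r + 1 + (r - 1) = p by ring]
      exact sub_mem hz.1 (Φ.anti _ _ _ (by omega) hc)
  · intro hzB
    obtain ⟨a, ha, b, -, rfl⟩ := Φ.mem_B.1 hzB
    obtain ⟨β, hβ⟩ := exists_isClassOf (hΦ.d_eq_zero_of_mem_Z (by omega) ha)
    have : α - β = 0 := (hα.sub hβ).eq_zero_iff.2 ⟨b, by abel⟩
    exact ⟨a, ha.1, sub_eq_zero.1 this ▸ hβ⟩

theorem exists_page_equiv_grH (hΦ : Φ.IsFirstQuadrant) (p n : ℕ) (r : ℤ)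
    (hp : (p : ℤ) < r) (hn : (n : ℤ) + 1 < r) :
    ∃ ε : (Φ.page r).X (p, n) ≃ₗ[𝔽] Φ.grH p (p + n), ∀ z : Φ.Z r p (p + n),
      ∃ b : Φ.FH p (p + n), IsClassOf K (p + n) z b ∧
        ε (Φ.toPage r (p, n) z) = Submodule.Quotient.mk b := by
  have hr : ((p + n : ℕ) : ℤ) + 1 < p + r := by push_cast; omega
  obtain ⟨χ, hχ⟩ := exists_linear_isClassOf (Φ.Z r p (p + n)).subtype
    fun z => hΦ.d_eq_zero_of_mem_Z hr z.2
  let χ' : Φ.Z r p (p + n) →ₗ[𝔽] Φ.FH p (p + n) :=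
    χ.codRestrict _ fun z => mem_FH.2 ⟨z, z.2.1, hχ z⟩
  have hsurj : Function.Surjective χ' := fun b => by
    obtain ⟨c, hc, hcb⟩ := mem_FH.1 b.2
    exact ⟨⟨c, Φ.mem_Z_of_d_eq_zero hc (hcb.d_eq_zero _) _⟩, Subtype.ext ((hχ _).unique hcb)⟩
  have hker (z : Φ.Z r p (p + n)) :
      ((Φ.FH (p + 1) (p + n)).submoduleOf (Φ.FH p (p + n))).mkQ (χ' z) = 0 ↔
        z ∈ (Φ.B r p (p + n)).submoduleOf _ :=
    (Submodule.Quotient.mk_eq_zero _).trans (hΦ.mem_FH_succ_iff hp hr z.2 (hχ z))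
  obtain ⟨ε, hε⟩ := exists_quotient_equiv _ (Submodule.mkQ _ ∘ₗ χ')
    ((Submodule.mkQ_surjective _).comp hsurj) hker
  exact ⟨ε, fun z => ⟨χ' z, hχ z, hε z⟩⟩

end IsFirstQuadrant

end Filtration

/-! ### Restriction of the last arguments and shuffle extensions -/

section Split

variable {𝔽 L H M : Type*} [Field 𝔽] [AddCommGroup L] [Module 𝔽 L] [AddCommGroup H] [Module 𝔽 H]
  [AddCommGroup M] [Module 𝔽 M]

/-- Restriction of multilinear maps along `ι : H → L`. -/
def res (ι : H →ₗ[𝔽] L) (n : ℕ) : ML 𝔽 L M n →ₗ[𝔽] ML 𝔽 H M n where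
  toFun f := f.compLinearMap fun _ => ι
  map_add' _ _ := rfl
  map_smul' _ _ := rfl

theorem res_apply (ι : H →ₗ[𝔽] L) (n : ℕ) (f : ML 𝔽 L M n) (y : Fin n → H) :
    res ι n f y = f (ι ∘ y) := rfl

theorem ins_res (ι : H →ₗ[𝔽] L) (n : ℕ) (f : ML 𝔽 L M (n + 1)) (y : H) :
    ins y n (res ι (n + 1) f) = res ι n (ins (ι y) n f) := by
  ext z
  simp only [ins_apply, res_apply]
  congr 1
  funext i
  refine Fin.cases ?_ (fun i => ?_) i <;> simp

theorem theta_res {ι : H →ₗ[𝔽] L} {D : L →ₗ[𝔽] L} {D' : H →ₗ[𝔽] H} (hD : ∀ y, ι (D' y) = D (ι y))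
    (A : M →ₗ[𝔽] M) (n : ℕ) (f : ML 𝔽 L M n) :
    theta A D' n (res ι n f) = res ι n (theta A D n f) := by
  ext y
  simp only [theta_apply, res_apply]
  congr 1
  refine Finset.sum_congr rfl fun i _ => ?_
  rw [Function.comp_update, hD]
  rfl

/-- The first `p` arguments in `L` and the remaining `n` ones in `H`:
`x ↦ y ↦ f(x₁, …, xₚ, ι y₁, …, ι yₙ)`. The equality `N = p + n` is an argument because the
induction on `p` changes the shape of `N`. -/
def splitRes (ι : H →ₗ[𝔽] L) (p n N : ℕ) (hN : N = p + n) :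
    ML 𝔽 L M N →ₗ[𝔽] ML 𝔽 L (ML 𝔽 H M n) p where
  toFun f := (res ι n).compMultilinearMap
    (f.domDomCongr ((finCongr hN).trans finSumFinEquiv.symm)).currySum
  map_add' _ _ := rfl
  map_smul' _ _ := rfl

theorem splitRes_apply (ι : H →ₗ[𝔽] L) {p n N : ℕ} (hN : N = p + n) (f : ML 𝔽 L M N)
    (x : Fin p → L) (y : Fin n → H) :
    splitRes ι p n N hN f x y = f fun i => Fin.append x (ι ∘ y) (Fin.cast hN i) := by
  change f _ = f _
  congr 1
  funext i
  obtain ⟨j, rfl⟩ := (finCongr hN.symm).surjective i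
  obtain ⟨k, rfl⟩ := finSumFinEquiv.surjective j
  rcases k with k | k <;> simp

theorem splitRes_zero (ι : H →ₗ[𝔽] L) {n : ℕ} (hN : n = 0 + n) (f : ML 𝔽 L M n) (x : Fin 0 → L) :
    splitRes ι 0 n n hN f x = res ι n f := by
  ext y
  rw [splitRes_apply, res_apply, Fin.append_left_nil _ _ rfl]
  rfl

theorem ins_splitRes (ι : H →ₗ[𝔽] L) {p n N : ℕ} (hN : N + 1 = p + 1 + n) (hN' : N = p + n)
    (f : ML 𝔽 L M (N + 1)) (x : L) :
    ins x p (splitRes ι (p + 1) n (N + 1) hN f) = splitRes ι p n N hN' (ins x N f) := by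
  subst hN'
  ext z y
  simp only [ins_apply, splitRes_apply]
  congr 1
  funext i
  rw [Fin.append_cons]
  rfl

theorem ins_compMultilinearMap {P : Type*} [AddCommGroup P] [Module 𝔽 P] (A : M →ₗ[𝔽] P) (n : ℕ)
    (f : ML 𝔽 L M (n + 1)) (x : L) :
    ins x n (A.compMultilinearMap f) = A.compMultilinearMap (ins x n f) := rfl

theorem theta_splitRes {ι : H →ₗ[𝔽] L} {D : L →ₗ[𝔽] L} {D' : H →ₗ[𝔽] H}
    (hD : ∀ y, ι (D' y) = D (ι y)) (A : M →ₗ[𝔽] M) {p n N : ℕ} (hN : N = p + n) (f : ML 𝔽 L M N) :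
    theta (theta A D' n) D p (splitRes ι p n N hN f) =
      splitRes ι p n N hN (theta A D N f) := by
  induction p generalizing N with
  | zero =>
    obtain rfl : N = n := by omega
    ext x : 1
    rw [theta_zero_apply, splitRes_zero, splitRes_zero, theta_res hD]
  | succ p ih =>
    obtain ⟨N, rfl⟩ : ∃ N', N = N' + 1 := ⟨p + n, by omega⟩
    have hN' : N = p + n := by omega
    refine ext_ins fun x => ?_
    rw [ins_theta, ins_splitRes ι hN hN', ins_splitRes ι hN hN', ins_splitRes ι hN hN', ih,
      ins_theta, map_add]

theorem splitRes_mem_CS (ι : H →ₗ[𝔽] L) {p n N : ℕ} (hN : N = p + n) {f : ML 𝔽 L M N}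
    (hf : f ∈ CS 𝔽 L M N) : splitRes ι p n N hN f ∈ CS 𝔽 L (ML 𝔽 H M n) p := by
  subst hN
  intro σ x
  ext y
  rw [splitRes_apply, splitRes_apply]
  refine Eq.trans ?_ (hf (finSumFinEquiv.permCongr (Equiv.sumCongr σ (Equiv.refl _))) _)
  congr 1
  funext i
  obtain ⟨k, rfl⟩ := finSumFinEquiv.surjective i
  rcases k with k | k <;> simp [Equiv.permCongr_apply]

theorem splitRes_apply_mem_CS (ι : H →ₗ[𝔽] L) {p n N : ℕ} (hN : N = p + n) {f : ML 𝔽 L M N}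
    (hf : f ∈ CS 𝔽 L M N) (x : Fin p → L) : splitRes ι p n N hN f x ∈ CS 𝔽 H M n := by
  subst hN
  intro σ y
  rw [splitRes_apply, splitRes_apply]
  refine Eq.trans ?_ (hf (finSumFinEquiv.permCongr (Equiv.sumCongr (Equiv.refl _) σ)) _)
  congr 1
  funext i
  obtain ⟨k, rfl⟩ := finSumFinEquiv.surjective i
  rcases k with k | k <;> simp [Equiv.permCongr_apply]

end Split

section Shuffle

variable {𝔽 L Q H M : Type*} [Field 𝔽] [AddCommGroup L] [Module 𝔽 L] [AddCommGroup Q] [Module 𝔽 Q]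
  [AddCommGroup H] [Module 𝔽 H] [AddCommGroup M] [Module 𝔽 M]

theorem apply_comp_eq_of_range_eq {n : ℕ} {f : ML 𝔽 L M n} (hf : f ∈ CS 𝔽 L M n) {κ : Type*}
    (z : κ → L) {a b : Fin n → κ} (ha : Function.Injective a) (hb : Function.Injective b)
    (hab : Set.range a = Set.range b) : f (z ∘ a) = f (z ∘ b) := by
  let σ : Equiv.Perm (Fin n) := (Equiv.ofInjective a ha).trans
    ((Equiv.setCongr hab).trans (Equiv.ofInjective b hb).symm)
  have hσ : b ∘ σ = a := funext fun i => Equiv.apply_ofInjective_symm hb _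
  rw [← hσ]
  exact hf σ (z ∘ b)

theorem card_compl_of_card_eq {p n : ℕ} {S : Finset (Fin (p + n))} (hS : S.card = p) :
    Sᶜ.card = n := by
  rw [Finset.card_compl, hS, Fintype.card_fin, Nat.add_sub_cancel_left]

/-- The shuffle extension to `L` of a multilinear map in `p` arguments from `Q` and `n` arguments
from `H`: the sum over all choices of `p` of the `p + n` arguments, to which `pr : L → Q` is
applied, while `π : L → H` is applied to the other ones. -/
def shuffle (pr : L →ₗ[𝔽] Q) (π : L →ₗ[𝔽] H) {p n : ℕ} (F : ML 𝔽 Q (ML 𝔽 H M n) p) :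
    ML 𝔽 L M (p + n) :=
  ∑ S : {S : Finset (Fin (p + n)) // S.card = p},
    (MultilinearMap.curryFinFinset 𝔽 M L S.2 (card_compl_of_card_eq S.2)).symm
      ((res π n).compMultilinearMap (res pr p F))

theorem shuffle_apply (pr : L →ₗ[𝔽] Q) (π : L →ₗ[𝔽] H) {p n : ℕ} (F : ML 𝔽 Q (ML 𝔽 H M n) p)
    (z : Fin (p + n) → L) :
    shuffle pr π F z = ∑ S : {S : Finset (Fin (p + n)) // S.card = p},
      F ((pr ∘ z) ∘ S.1.orderEmbOfFin S.2)
        ((π ∘ z) ∘ S.1ᶜ.orderEmbOfFin (card_compl_of_card_eq S.2)) := by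
  rw [shuffle, sum_apply]
  refine Finset.sum_congr rfl fun S _ => ?_
  rw [MultilinearMap.curryFinFinset_symm_apply]
  simp only [finSumEquivOfFinset_inl, finSumEquivOfFinset_inr]
  rfl

theorem shuffle_mem_CS (pr : L →ₗ[𝔽] Q) (π : L →ₗ[𝔽] H) {p n : ℕ} {F : ML 𝔽 Q (ML 𝔽 H M n) p}
    (hF : F ∈ CS 𝔽 Q (ML 𝔽 H M n) p) (hF' : ∀ x, F x ∈ CS 𝔽 H M n) :
    shuffle pr π F ∈ CS 𝔽 L M (p + n) := by
  intro σ z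
  rw [shuffle_apply, shuffle_apply]
  refine Fintype.sum_equiv (σ.finsetCongr.subtypeEquiv fun S => by simp) _ _ fun S => ?_
  have hS : (S.1.map σ.toEmbedding).card = p := (Finset.card_map _).trans S.2
  have hpr : F ((pr ∘ z) ∘ (σ ∘ S.1.orderEmbOfFin S.2)) =
      F ((pr ∘ z) ∘ (S.1.map σ.toEmbedding).orderEmbOfFin hS) := by
    refine apply_comp_eq_of_range_eq hF _ (σ.injective.comp (RelEmbedding.injective _))
      (RelEmbedding.injective _) ?_
    rw [Set.range_comp, Finset.range_orderEmbOfFin, Finset.range_orderEmbOfFin, Finset.coe_map,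
      Equiv.coe_toEmbedding]
  have hπ (x : Fin p → Q) :
      F x ((π ∘ z) ∘ (σ ∘ S.1ᶜ.orderEmbOfFin (card_compl_of_card_eq S.2))) =
        F x ((π ∘ z) ∘ (S.1.map σ.toEmbedding)ᶜ.orderEmbOfFin (card_compl_of_card_eq hS)) := by
    refine apply_comp_eq_of_range_eq (hF' x) _ (σ.injective.comp (RelEmbedding.injective _))
      (RelEmbedding.injective _) ?_
    rw [Set.range_comp, Finset.range_orderEmbOfFin, Finset.range_orderEmbOfFin, Finset.coe_compl,
      Finset.coe_compl, Finset.coe_map, Equiv.coe_toEmbedding, Set.image_compl_eq σ.bijective]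
  exact (DFunLike.congr_fun hpr _).trans (hπ _)

theorem apply_orderEmbOfFin_eq_zero {n p : ℕ} {P : Type*} [AddCommGroup P] [Module 𝔽 P]
    (F : ML 𝔽 Q P p) {z : Fin n → Q} {S : Finset (Fin n)} (hS : S.card = p) {i : Fin n}
    (hi : i ∈ S) (hz : z i = 0) : F (z ∘ S.orderEmbOfFin hS) = 0 := by
  obtain ⟨j, rfl⟩ : i ∈ Set.range (S.orderEmbOfFin hS) := by
    rwa [Finset.range_orderEmbOfFin, Finset.mem_coe]
  exact F.map_coord_zero j hz

theorem shuffle_apply_eq_zero (pr : L →ₗ[𝔽] Q) (π : L →ₗ[𝔽] H) {p n : ℕ}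
    (F : ML 𝔽 Q (ML 𝔽 H M n) p) {z : Fin (p + n) → L} {T : Finset (Fin (p + n))}
    (hT : n < T.card) (hz : ∀ i ∈ T, pr (z i) = 0) : shuffle pr π F z = 0 := by
  rw [shuffle_apply]
  refine Finset.sum_eq_zero fun S _ => ?_
  obtain ⟨i, hiT, hiS⟩ : ∃ i ∈ T, i ∉ S.1ᶜ :=
    Finset.exists_mem_notMem_of_card_lt_card (by rwa [card_compl_of_card_eq S.2])
  rw [apply_orderEmbOfFin_eq_zero F S.2 (Finset.notMem_compl.1 hiS) (hz i hiT)]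
  rfl

theorem splitRes_shuffle {pr : L →ₗ[𝔽] Q} {π : L →ₗ[𝔽] H} {ι : H →ₗ[𝔽] L}
    (hpr : ∀ y, pr (ι y) = 0) (hπ : ∀ y, π (ι y) = y) {p n : ℕ} (F : ML 𝔽 Q (ML 𝔽 H M n) p) :
    splitRes ι p n (p + n) rfl (shuffle pr π F) = res pr p F := by
  ext x y
  let z := Fin.append x (ι ∘ y)
  let S₀ : Finset (Fin (p + n)) := Finset.univ.map (Fin.castAddEmb n)
  have hS₀ : S₀.card = p := by simp [S₀]
  have hmem {i : Fin (p + n)} (hi : i ∉ S₀) : pr (z i) = 0 := by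
    refine Fin.addCases (fun i hi => ?_) (fun i _ => ?_) i hi
    · simp [S₀] at hi
    · simp [z, hpr]
  rw [splitRes_apply]
  change shuffle pr π F z = _
  rw [shuffle_apply, Fintype.sum_eq_single ⟨S₀, hS₀⟩]
  · have hL : Fin.castAdd n = S₀.orderEmbOfFin hS₀ :=
      Finset.orderEmbOfFin_unique hS₀ (by simp [S₀]) (Fin.strictMono_castAdd n)
    have hR : Fin.natAdd p = S₀ᶜ.orderEmbOfFin (card_compl_of_card_eq hS₀) :=
      Finset.orderEmbOfFin_unique _ (by simp [S₀, Fin.ext_iff]; omega) (Fin.strictMono_natAdd p)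
    have hx : (pr ∘ z) ∘ Fin.castAdd n = pr ∘ x := funext fun i => by simp [z]
    have hy : (π ∘ z) ∘ Fin.natAdd p = y := funext fun i => by simp [z, hπ]
    rw [← hL, ← hR, hx, hy, res_apply]
  · intro S hS
    obtain ⟨i, hiS, hi⟩ : ∃ i ∈ S.1, i ∉ S₀ := Finset.not_subset.1 fun h =>
      hS (Subtype.ext (Finset.eq_of_subset_of_card_le h (hS₀.trans S.2.symm).le))
    rw [apply_orderEmbOfFin_eq_zero F S.2 hiS (hmem hi)]
    rfl

end Shuffle

/-! ### Cochains of an extension -/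

section Extension

variable {𝔽 h g q M : Type*} [Field 𝔽]
  [AddCommGroup h] [Module 𝔽 h] [CommLieAlgebra 𝔽 h]
  [AddCommGroup g] [Module 𝔽 g] [CommLieAlgebra 𝔽 g]
  [AddCommGroup q] [Module 𝔽 q] [CommLieAlgebra 𝔽 q]
  [AddCommGroup M] [Module 𝔽 M]
  (e : CommLieExtension 𝔽 h g q) (ρ : CommLieRep 𝔽 g M)

theorem res_ce (n : ℕ) (f : ML 𝔽 g M n) :
    ce (restrictRep e ρ) n (res e.incl n f) = res e.incl (n + 1) (ce ρ n f) := by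
  induction n with
  | zero =>
    refine ext_ins fun y => ?_
    rw [ins_ce_zero, ins_res, ins_ce_zero]
    exact theta_res (e.incl_bracket y) (ρ.act (e.incl y)) 0 f
  | succ n ih =>
    refine ext_ins fun y => ?_
    rw [ins_ce_succ, ins_res, ins_res, ins_ce_succ, ih, map_add]
    congr 1
    exact theta_res (e.incl_bracket y) (ρ.act (e.incl y)) _ f

theorem splitRes_zero_ce {n N : ℕ} (hN : N + 1 = 0 + (n + 1)) (hN' : N = 0 + n)
    (f : ML 𝔽 g M N) :
    splitRes e.incl 0 (n + 1) (N + 1) hN (ce ρ N f) =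
      (ce (restrictRep e ρ) n).compMultilinearMap (splitRes e.incl 0 n N hN' f) := by
  obtain rfl : N = n := by omega
  ext x : 1
  rw [splitRes_zero, LinearMap.compMultilinearMap_apply, splitRes_zero, res_ce]

theorem exists_perm_forall_natAdd_mem {p n : ℕ} {S : Finset (Fin (p + n))} (hS : n ≤ S.card) :
    ∃ σ : Equiv.Perm (Fin (p + n)), ∀ j : Fin n, σ (Fin.natAdd p j) ∈ S := by
  obtain ⟨T, hTS, hT⟩ := Finset.exists_subset_card_eq hS
  let U : Finset (Fin (p + n)) := Finset.univ.map (Fin.natAddEmb p)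
  have hU : U.card = T.card := by simp [U, hT]
  exact ⟨(Finset.equivOfCardEq hU).extendSubtype, fun j =>
    hTS (Equiv.extendSubtype_mem _ _ (by simp [U]))⟩

theorem vanishesOn_succ_iff {p n N : ℕ} (hN : N = p + n) {f : ML 𝔽 g M N} (hf : f ∈ CS 𝔽 g M N) :
    VanishesOn e (p + 1) N f ↔ splitRes e.incl p n N hN f = 0 := by
  subst hN
  constructor
  · intro h
    ext x y
    rw [splitRes_apply]
    refine h _ (Finset.univ.map (Fin.natAddEmb p)) (by simp) fun i hi => ?_
    obtain ⟨j, -, rfl⟩ := Finset.mem_map.1 hi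
    simp
  · intro h x S hS hx
    obtain ⟨σ, hσ⟩ := exists_perm_forall_natAdd_mem (S := S) (n := n) (by push_cast at hS; omega)
    choose y hy using fun j => hx _ (hσ j)
    have hfσ : f (x ∘ σ) = splitRes e.incl p n (p + n) rfl f (x ∘ σ ∘ Fin.castAdd n) y := by
      rw [splitRes_apply]
      congr 1
      funext i
      refine Fin.addCases (fun i => ?_) (fun i => ?_) i <;> simp [hy]
    rw [← hf σ, hfσ, h]
    rfl

theorem VanishesOn.splitRes_eq_zero {p n N : ℕ} (hN : N = p + n) {f : ML 𝔽 g M N}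
    (hf : VanishesOn e p N f) (x : Fin p → g) (i : Fin p) (hi : x i ∈ LinearMap.range e.incl) :
    splitRes e.incl p n N hN f x = 0 := by
  subst hN
  ext y
  rw [splitRes_apply]
  have hnotMem : Fin.castAdd n i ∉ Finset.univ.map (Fin.natAddEmb p) := by
    simp [Fin.ext_iff]
    omega
  refine hf _ (insert (Fin.castAdd n i) (Finset.univ.map (Fin.natAddEmb p))) ?_ fun j hj => ?_
  · rw [Finset.card_insert_of_notMem hnotMem]
    simp
  · rcases Finset.mem_insert.1 hj with rfl | hj
    · simpa using hi
    · obtain ⟨k, -, rfl⟩ := Finset.mem_map.1 hj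
      simp

theorem map_eq_map_of_forall_sub_mem {R ι N : Type*} {V : ι → Type*} [Ring R] [Finite ι]
    [∀ i, AddCommGroup (V i)] [∀ i, Module R (V i)] [AddCommGroup N] [Module R N]
    (f : MultilinearMap R V N) (K : ∀ i, Submodule R (V i)) (hf : ∀ x i, x i ∈ K i → f x = 0)
    {x x' : ∀ i, V i} (h : ∀ i, x i - x' i ∈ K i) : f x = f x' := by
  classical
  have := Fintype.ofFinite ι
  let : LinearOrder ι := linearOrderOfSTO WellOrderingRel
  have hsub := f.map_piecewise_sub_map_piecewise x x' x Finset.univ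
  rw [Finset.piecewise_univ, Finset.piecewise_univ] at hsub
  rw [← sub_eq_zero, hsub]
  exact Finset.sum_eq_zero fun i _ => hf _ i (by simpa using h i)

variable {e} in
theorem VanishesOn.splitRes_congr {p n N : ℕ} (hN : N = p + n) {f : ML 𝔽 g M N}
    (hf : VanishesOn e p N f) {x x' : Fin p → g} (hx : e.proj ∘ x = e.proj ∘ x') :
    splitRes e.incl p n N hN f x = splitRes e.incl p n N hN f x' := by
  refine map_eq_map_of_forall_sub_mem _ (fun _ => LinearMap.range e.incl)
    (fun y i hi => hf.splitRes_eq_zero e hN y i hi) fun i => (e.exact _).1 ?_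
  rw [map_sub, sub_eq_zero]
  exact congrFun hx i

theorem shuffle_vanishesOn (π : g →ₗ[𝔽] h) {p n : ℕ} (F : ML 𝔽 q (ML 𝔽 h M n) p) :
    VanishesOn e p (p + n) (shuffle e.proj π F) := fun x S hS hx =>
  shuffle_apply_eq_zero e.proj π F (T := S) (by push_cast at hS; omega)
    fun i hi => (e.exact _).2 (hx i hi)

theorem exists_vanishesOn_splitRes_eq {p n N : ℕ} (hN : N = p + n) {F : ML 𝔽 q (ML 𝔽 h M n) p}
    (hF : F ∈ CS 𝔽 q (ML 𝔽 h M n) p) (hF' : ∀ x, F x ∈ CS 𝔽 h M n) :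
    ∃ f ∈ CS 𝔽 g M N, VanishesOn e p N f ∧ splitRes e.incl p n N hN f = res e.proj p F := by
  subst hN
  obtain ⟨π, hπ⟩ := e.incl.exists_leftInverse_of_injective (LinearMap.ker_eq_bot.2 e.incl_injective)
  exact ⟨shuffle e.proj π F, shuffle_mem_CS _ _ hF hF', shuffle_vanishesOn e π F,
    splitRes_shuffle e.exact.apply_apply_eq_zero (LinearMap.congr_fun hπ) F⟩

variable [CharP 𝔽 2]

theorem adj_bracket (x y : g) :
    adj e (lieBr 𝔽 x y) = adj e x ∘ₗ adj e y + adj e y ∘ₗ adj e x := by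
  ext z
  apply e.incl_injective
  simp only [incl_adj, LinearMap.add_apply, LinearMap.comp_apply, map_add]
  have jacobi := CommLieAlgebra.jacobi (𝔽 := 𝔽) x y (e.incl z)
  have two_eq_zero := add_self (𝔽 := 𝔽) (lieBr 𝔽 (e.incl z) (lieBr 𝔽 x y))
  rw [CommLieAlgebra.bracket_comm (e.incl z) x] at jacobi
  rw [CommLieAlgebra.bracket_comm (lieBr 𝔽 x y)]
  linear_combination (norm := module) two_eq_zero - jacobi

/-- The action `(x · f)(y₁, …, yₙ) = x · f(y₁, …, yₙ) + ∑ᵢ f(y₁, …, [x, yᵢ], …, yₙ)` of `g` on the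
multilinear cochains of `h`. -/
noncomputable def cochainRep (n : ℕ) : CommLieRep 𝔽 g (ML 𝔽 h M n) where
  act :=
    { toFun := fun x => theta (ρ.act x) (adj e x) n
      map_add' := fun x y => by
        ext f : 1
        rw [map_add, map_add, theta_add]
        rfl
      map_smul' := fun c x => by
        ext f : 1
        rw [map_smul, map_smul, theta_smul]
        rfl }
  act_bracket x y f := by
    change theta _ _ n f = theta _ _ n (theta _ _ n f) + theta _ _ n (theta _ _ n f)
    rw [theta_comm, adj_bracket]
    congr 2
    ext m
    simp [ρ.act_bracket]

theorem lieDer_splitRes {p n N : ℕ} (hN : N = p + n) (f : ML 𝔽 g M N) (x : g) :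
    lieDer (cochainRep e ρ n) x p (splitRes e.incl p n N hN f) =
      splitRes e.incl p n N hN (lieDer ρ x N f) :=
  theta_splitRes (incl_adj e x) (ρ.act x) hN f

theorem splitRes_succ_zero_ce {p N : ℕ} (hN : N + 1 = p + 1 + 0) (hN' : N = p + 0)
    (f : ML 𝔽 g M N) :
    splitRes e.incl (p + 1) 0 (N + 1) hN (ce ρ N f) =
      ce (cochainRep e ρ 0) p (splitRes e.incl p 0 N hN' f) := by
  induction p generalizing N with
  | zero =>
    obtain rfl : N = 0 := by omega
    refine ext_ins fun x => ?_
    rw [ins_splitRes e.incl hN hN', ins_ce_zero, ins_ce_zero, lieDer_splitRes]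
  | succ p ih =>
    obtain ⟨N, rfl⟩ : ∃ N', N = N' + 1 := ⟨p, by omega⟩
    have hN'' : N = p + 0 := by omega
    refine ext_ins fun x => ?_
    rw [ins_splitRes e.incl hN hN', ins_ce_succ, ins_ce_succ, lieDer_splitRes, map_add, ih hN' hN'',
      ins_splitRes e.incl hN' hN'']

theorem splitRes_succ_succ_ce {p n N : ℕ} (hN : N + 1 = p + 1 + (n + 1)) (hp : N = p + (n + 1))
    (hn : N = p + 1 + n) (f : ML 𝔽 g M N) :
    splitRes e.incl (p + 1) (n + 1) (N + 1) hN (ce ρ N f) =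
      ce (cochainRep e ρ (n + 1)) p (splitRes e.incl p (n + 1) N hp f) +
        (ce (restrictRep e ρ) n).compMultilinearMap (splitRes e.incl (p + 1) n N hn f) := by
  induction p generalizing N with
  | zero =>
    obtain rfl : N = n + 1 := by omega
    have hn' : n = 0 + n := by omega
    refine ext_ins fun x => ?_
    rw [map_add, ins_splitRes e.incl hN hp, ins_ce_succ, map_add, ← lieDer_splitRes e ρ hp,
      ins_compMultilinearMap, ins_splitRes e.incl hn hn', ins_ce_zero, splitRes_zero_ce e ρ hp hn']
  | succ p ih =>
    obtain ⟨N, rfl⟩ : ∃ N', N = N' + 1 := ⟨p + (n + 1), by omega⟩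
    have hp' : N = p + (n + 1) := by omega
    have hn' : N = p + 1 + n := by omega
    refine ext_ins fun x => ?_
    rw [map_add, ins_splitRes e.incl hN hp, ins_ce_succ, ins_ce_succ, map_add,
      ← lieDer_splitRes e ρ hp, ins_compMultilinearMap, ins_splitRes e.incl hn hn',
      ins_splitRes e.incl hp hp', ih hp hp' hn', add_assoc]

theorem splitRes_ce_of_vanishesOn {p n N : ℕ} (hN : N = p + n) (hN' : N + 1 = p + (n + 1))
    {f : ML 𝔽 g M N} (hf : f ∈ CS 𝔽 g M N) (hfp : VanishesOn e p N f) :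
    splitRes e.incl p (n + 1) (N + 1) hN' (ce ρ N f) =
      (ce (restrictRep e ρ) n).compMultilinearMap (splitRes e.incl p n N hN f) := by
  cases p with
  | zero => exact splitRes_zero_ce e ρ hN' hN f
  | succ p =>
    have hp : N = p + (n + 1) := by omega
    push_cast at hfp
    rw [splitRes_succ_succ_ce e ρ hN' hp hN, (vanishesOn_succ_iff e hp hf).1 hfp, map_zero,
      zero_add]

theorem vanishesOn_succ_ce_iff {p n N : ℕ} (hN : N = p + n) {f : ML 𝔽 g M N}
    (hf : f ∈ CS 𝔽 g M N) (hfp : VanishesOn e p N f) :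
    VanishesOn e (p + 1) (N + 1) (ce ρ N f) ↔
      ∀ x, ce (restrictRep e ρ) n (splitRes e.incl p n N hN f x) = 0 := by
  have hN' : N + 1 = p + (n + 1) := by omega
  rw [vanishesOn_succ_iff e hN' (ce_mem_CS ρ hf), splitRes_ce_of_vanishesOn e ρ hN hN' hf hfp]
  exact MultilinearMap.ext_iff

end Extension

/-! ### Linear choices of classes, representatives and primitives -/

section ClassMap

universe v

variable {𝔽 : Type u} {L : Type v} {M : Type w} [Field 𝔽] [AddCommGroup L] [Module 𝔽 L]
  [AddCommGroup M] [Module 𝔽 M] [CommLieAlgebra 𝔽 L] (ρ : CommLieRep 𝔽 L M)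

theorem exists_linear_primitive (n : ℕ) : ∃ τ : ML 𝔽 L M (n + 1) →ₗ[𝔽] ML 𝔽 L M n,
    (∀ f, τ f ∈ CS 𝔽 L M n) ∧ ∀ f ∈ CS 𝔽 L M n, ce ρ n (τ (ce ρ n f)) = ce ρ n f := by
  let D := ce ρ n ∘ₗ (CS 𝔽 L M n).subtype
  obtain ⟨r, hr⟩ := D.rangeRestrict.exists_rightInverse_of_surjective D.range_rangeRestrict
  obtain ⟨t, ht⟩ := r.exists_extend
  refine ⟨(CS 𝔽 L M n).subtype ∘ₗ t, fun f => (t f).2, fun f hf => ?_⟩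
  have htr : t (ce ρ n f) = r (D.rangeRestrict ⟨f, hf⟩) :=
    LinearMap.congr_fun ht (D.rangeRestrict ⟨f, hf⟩)
  rw [LinearMap.comp_apply, htr]
  exact congrArg Subtype.val (LinearMap.congr_fun hr (D.rangeRestrict ⟨f, hf⟩))

variable [CharP 𝔽 2]

theorem exists_ev_eq {n : ℕ} {f : ML 𝔽 L M n} (hf : f ∈ CS 𝔽 L M n) :
    ∃ w : (csComplex ρ).X n, ev ρ n w = f := ⟨(⟨f, hf⟩ : CS 𝔽 L M n), rfl⟩

/-- `c` sends each symmetric cocycle to its cohomology class. It is defined on all multilinear maps,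
with arbitrary values outside the symmetric cocycles, so that it can be composed with
multilinear maps. -/
def IsClassMap (n : ℕ) (c : ML 𝔽 L M n →ₗ[𝔽] HS ρ n) : Prop :=
  ∀ w a, IsClassOf (csComplex ρ) n w a → c (ev ρ n w) = a

theorem exists_isClassMap (n : ℕ) : ∃ c, IsClassMap ρ n c := by
  obtain ⟨l, hl⟩ := (ev ρ n ∘ₗ ((csComplex ρ).iCycles n).hom).exists_leftInverse_of_injective
    (LinearMap.ker_eq_bot.2 ((ev_injective ρ n).comp (iCycles_injective _ n)))
  refine ⟨((csComplex ρ).homologyπ n).hom ∘ₗ l, ?_⟩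
  rintro _ _ ⟨k, rfl, rfl⟩
  exact congrArg ((csComplex ρ).homologyπ n).hom (LinearMap.congr_fun hl k)

theorem exists_linear_representative (n : ℕ) : ∃ σ : HS ρ n →ₗ[𝔽] (csComplex ρ).X n,
    ∀ a, IsClassOf (csComplex ρ) n (σ a) a := by
  obtain ⟨r, hr⟩ := ((csComplex ρ).homologyπ n).hom.exists_rightInverse_of_surjective
    (LinearMap.range_eq_top.2 (homologyπ_surjective _ n))
  exact ⟨((csComplex ρ).iCycles n).hom ∘ₗ r, fun a => ⟨r a, rfl, LinearMap.congr_fun hr a⟩⟩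

variable {ρ} {n : ℕ}

namespace IsClassMap

theorem isClassOf {c : ML 𝔽 L M n →ₗ[𝔽] HS ρ n} (hc : IsClassMap ρ n c) {w : (csComplex ρ).X n}
    (hw : ce ρ n (ev ρ n w) = 0) : IsClassOf (csComplex ρ) n w (c (ev ρ n w)) := by
  obtain ⟨a, ha⟩ := exists_isClassOf (K := csComplex ρ) (c := w)
    (ev_injective ρ (n + 1) (by rw [ev_d, hw, map_zero]))
  rwa [hc w a ha]

theorem apply_ce {c : ML 𝔽 L M (n + 1) →ₗ[𝔽] HS ρ (n + 1)} (hc : IsClassMap ρ (n + 1) c)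
    {f : ML 𝔽 L M n} (hf : f ∈ CS 𝔽 L M n) : c (ce ρ n f) = 0 := by
  obtain ⟨w, rfl⟩ := exists_ev_eq ρ hf
  rw [← ev_d]
  exact (hc.isClassOf (by rw [ev_d, ce_ce])).eq_zero_iff.2 ⟨w, rfl⟩

theorem exists_ce_eq {c : ML 𝔽 L M (n + 1) →ₗ[𝔽] HS ρ (n + 1)} (hc : IsClassMap ρ (n + 1) c)
    {f : ML 𝔽 L M (n + 1)} (hf : f ∈ CS 𝔽 L M (n + 1)) (hd : ce ρ (n + 1) f = 0) (h0 : c f = 0) :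
    ∃ b ∈ CS 𝔽 L M n, ce ρ n b = f := by
  obtain ⟨w, rfl⟩ := exists_ev_eq ρ hf
  obtain ⟨b, rfl⟩ := (hc.isClassOf hd).eq_zero_iff.1 h0
  exact ⟨ev ρ n b, ev_mem ρ n b, (ev_d ρ n b).symm⟩

theorem eq_zero {c : ML 𝔽 L M 0 →ₗ[𝔽] HS ρ 0} (hc : IsClassMap ρ 0 c) {f : ML 𝔽 L M 0}
    (hd : ce ρ 0 f = 0) (h0 : c f = 0) : f = 0 := by
  obtain ⟨w, rfl⟩ := exists_ev_eq ρ (mem_CS_zero f)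
  obtain ⟨b, rfl⟩ := (hc.isClassOf hd).eq_zero_iff.1 h0
  rw [(csComplex ρ).shape (0 - 1) 0 (by simp)]
  exact map_zero _

end IsClassMap

end ClassMap

/-! ### The second page -/

section HochschildSerre

variable {𝔽 : Type u} {h : Type vh} {g : Type vg} {q : Type vq} {M : Type w} [Field 𝔽] [CharP 𝔽 2]
  [AddCommGroup h] [Module 𝔽 h] [CommLieAlgebra 𝔽 h]
  [AddCommGroup g] [Module 𝔽 g] [CommLieAlgebra 𝔽 g]
  [AddCommGroup q] [Module 𝔽 q] [CommLieAlgebra 𝔽 q]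
  [AddCommGroup M] [Module 𝔽 M]
  {e : CommLieExtension 𝔽 h g q} {ρ : CommLieRep 𝔽 g M}
  {n : ℕ} {c : ML 𝔽 h M n →ₗ[𝔽] HS (restrictRep e ρ) n} {s : q →ₗ[𝔽] g}

theorem IsClassMap.actHS_apply (hc : IsClassMap (restrictRep e ρ) n c) (x : g) {f : ML 𝔽 h M n}
    (hf : f ∈ CS 𝔽 h M n) (hd : ce (restrictRep e ρ) n f = 0) :
    actHS e ρ n x (c f) = c ((cochainRep e ρ n).act x f) := by
  obtain ⟨w, rfl⟩ := exists_ev_eq (restrictRep e ρ) hf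
  obtain ⟨k, hk, hkc⟩ := hc.isClassOf hd
  refine (hc ((thetaHom (isDerPair_adj e ρ x)).f n w) _
    ⟨HomologicalComplex.cyclesMap (thetaHom (isDerPair_adj e ρ x)) n k, ?_, ?_⟩).symm
  · rw [← ModuleCat.comp_apply, HomologicalComplex.cyclesMap_i, ModuleCat.comp_apply, hk]
  · rw [← ModuleCat.comp_apply, ← HomologicalComplex.homologyπ_naturality, ModuleCat.comp_apply,
      hkc]
    rfl

/-- The cochain on `q` with values in `HSⁿ(h, M)` induced by a cochain on `g`, defined by means of a
section `s` of `g → q` and a class map `c`. -/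
noncomputable def inducedML (c : ML 𝔽 h M n →ₗ[𝔽] HS (restrictRep e ρ) n) (s : q →ₗ[𝔽] g)
    (p N : ℕ) (hN : N = p + n) : ML 𝔽 g M N →ₗ[𝔽] ML 𝔽 q (HS (restrictRep e ρ) n) p where
  toFun f := c.compMultilinearMap (res s p (splitRes e.incl p n N hN f))
  map_add' f f' := by ext; simp
  map_smul' a f := by ext; simp

theorem inducedML_apply (c : ML 𝔽 h M n →ₗ[𝔽] HS (restrictRep e ρ) n) (s : q →ₗ[𝔽] g)
    {p N : ℕ} (hN : N = p + n) (f : ML 𝔽 g M N) (x : Fin p → q) :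
    inducedML c s p N hN f x = c (splitRes e.incl p n N hN f (s ∘ x)) := rfl

theorem inducedML_mem_CS (c : ML 𝔽 h M n →ₗ[𝔽] HS (restrictRep e ρ) n) (s : q →ₗ[𝔽] g) {p N : ℕ}
    (hN : N = p + n) {f : ML 𝔽 g M N} (hf : f ∈ CS 𝔽 g M N) :
    inducedML c s p N hN f ∈ CS 𝔽 q (HS (restrictRep e ρ) n) p := fun σ x => by
  rw [inducedML_apply, inducedML_apply, ← Function.comp_assoc, splitRes_mem_CS _ hN hf]

theorem VanishesOn.inducedML_comp_proj (hs : Function.LeftInverse e.proj s) {p N : ℕ}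
    (hN : N = p + n) {f : ML 𝔽 g M N} (hf : VanishesOn e p N f) (x : Fin p → g) :
    inducedML c s p N hN f (e.proj ∘ x) = c (splitRes e.incl p n N hN f x) := by
  rw [inducedML_apply]
  exact congrArg c (hf.splitRes_congr hN (funext fun i => hs _))

theorem ce_inducedML_apply (hc : IsClassMap (restrictRep e ρ) n c)
    (hs : Function.LeftInverse e.proj s) {p N : ℕ} (hN : N = p + n) {f : ML 𝔽 g M N}
    (hf : f ∈ CS 𝔽 g M N) (hfp : VanishesOn e p N f)
    (hd : VanishesOn e (p + 1) (N + 1) (ce ρ N f)) (x : Fin (p + 1) → q) :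
    ce (quotRep e ρ n) p (inducedML c s p N hN f) x =
      c (ce (cochainRep e ρ n) p (splitRes e.incl p n N hN f) (s ∘ x)) := by
  have hcocycle := (vanishesOn_succ_ce_iff e ρ hN hf hfp).1 hd
  rw [ce_apply, ce_apply, ceSum, ceSum, map_add, map_sum, map_sum]
  congr 1
  · refine Finset.sum_congr rfl fun i _ => ?_
    rw [← hs (x i), quotRep_act_proj, inducedML_apply,
      hc.actHS_apply _ (splitRes_apply_mem_CS _ hN hf _) (hcocycle _)]
    rfl
  · refine Finset.sum_congr rfl fun i _ => ?_
    rw [map_sum]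
    refine Finset.sum_congr rfl fun j _ => ?_
    split_ifs
    · rw [← hfp.inducedML_comp_proj hs, Function.comp_update, e.proj_bracket]
      simp only [Function.comp_apply, hs _]
      congr 2
      exact funext fun k => (hs _).symm
    · rw [map_zero]

theorem inducedML_ce (hc : IsClassMap (restrictRep e ρ) n c) (hs : Function.LeftInverse e.proj s)
    {p N : ℕ} (hN : N = p + n) (hN' : N + 1 = p + 1 + n) {f : ML 𝔽 g M N} (hf : f ∈ CS 𝔽 g M N)
    (hfp : VanishesOn e p N f) (hd : VanishesOn e (p + 1) (N + 1) (ce ρ N f)) :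
    inducedML c s (p + 1) (N + 1) hN' (ce ρ N f) =
      ce (quotRep e ρ n) p (inducedML c s p N hN f) := by
  ext x
  rw [ce_inducedML_apply hc hs hN hf hfp hd, inducedML_apply]
  cases n with
  | zero => rw [splitRes_succ_zero_ce e ρ hN' hN]
  | succ n =>
    rw [splitRes_succ_succ_ce e ρ hN' hN (by omega : N = p + 1 + n), add_apply, map_add,
      LinearMap.compMultilinearMap_apply, hc.apply_ce (splitRes_apply_mem_CS _ _ hf _), add_zero]

theorem exists_inducedML_eq (hc : IsClassMap (restrictRep e ρ) n c)
    (hs : Function.LeftInverse e.proj s) {p N : ℕ} (hN : N = p + n)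
    {φ : ML 𝔽 q (HS (restrictRep e ρ) n) p} (hφ : φ ∈ CS 𝔽 q (HS (restrictRep e ρ) n) p) :
    ∃ f ∈ CS 𝔽 g M N, VanishesOn e p N f ∧ VanishesOn e (p + 1) (N + 1) (ce ρ N f) ∧
      inducedML c s p N hN f = φ := by
  obtain ⟨σ, hσ⟩ := exists_linear_representative (restrictRep e ρ) n
  obtain ⟨f, hf, hfp, hfσ⟩ := exists_vanishesOn_splitRes_eq e hN
    (F := (ev (restrictRep e ρ) n ∘ₗ σ).compMultilinearMap φ)
    (fun τ x => congrArg (ev (restrictRep e ρ) n ∘ₗ σ) (hφ τ x)) fun x => ev_mem _ _ _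
  refine ⟨f, hf, hfp, (vanishesOn_succ_ce_iff e ρ hN hf hfp).2 fun x => ?_, ?_⟩
  · rw [hfσ]
    change ce _ n (ev _ n (σ (φ (e.proj ∘ x)))) = 0
    rw [← ev_d, (hσ _).d_eq_zero, map_zero]
  · ext x
    have hx : e.proj ∘ s ∘ x = x := funext fun i => hs _
    rw [inducedML_apply, hfσ, res_apply, hx]
    exact hc _ _ (hσ (φ x))

theorem exists_vanishesOn_sub_ce {c : ML 𝔽 h M (n + 1) →ₗ[𝔽] HS (restrictRep e ρ) (n + 1)}
    (hc : IsClassMap (restrictRep e ρ) (n + 1) c) (hs : Function.LeftInverse e.proj s)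
    {p N : ℕ} (hN : N + 1 = p + (n + 1)) {f : ML 𝔽 g M (N + 1)} (hf : f ∈ CS 𝔽 g M (N + 1))
    (hfp : VanishesOn e p (N + 1) f) (hd : VanishesOn e (p + 1) (N + 1 + 1) (ce ρ (N + 1) f))
    (h0 : inducedML c s p (N + 1) hN f = 0) :
    ∃ v ∈ CS 𝔽 g M N, VanishesOn e p N v ∧ VanishesOn e (p + 1) (N + 1) (f - ce ρ N v) := by
  obtain ⟨τ, hτ, hτd⟩ := exists_linear_primitive (restrictRep e ρ) n
  have hN' : N = p + n := by omega
  have hexact (x : Fin p → g) : ∃ b ∈ CS 𝔽 h M n,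
      ce (restrictRep e ρ) n b = splitRes e.incl p (n + 1) (N + 1) hN f x := by
    refine hc.exists_ce_eq (splitRes_apply_mem_CS _ hN hf x)
      ((vanishesOn_succ_ce_iff e ρ hN hf hfp).1 hd x) ?_
    rw [← hfp.inducedML_comp_proj hs, h0]
    rfl
  obtain ⟨v, hv, hvp, hvτ⟩ := exists_vanishesOn_splitRes_eq e hN'
    (F := τ.compMultilinearMap (res s p (splitRes e.incl p (n + 1) (N + 1) hN f)))
    (fun σ x => congrArg τ (splitRes_mem_CS e.incl hN hf σ (s ∘ x))) fun x => hτ _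
  refine ⟨v, hv, hvp, (vanishesOn_succ_iff e hN (sub_mem hf (ce_mem_CS ρ hv))).2 ?_⟩
  rw [map_sub, splitRes_ce_of_vanishesOn e ρ hN' hN hv hvp, hvτ, sub_eq_zero]
  ext1 x
  obtain ⟨b, hb, hbx⟩ := hexact x
  have hsx : splitRes e.incl p (n + 1) (N + 1) hN f (s ∘ e.proj ∘ x) = ce (restrictRep e ρ) n b :=
    (hfp.splitRes_congr hN (funext fun i => hs _)).trans hbx.symm
  simp only [LinearMap.compMultilinearMap_apply, res_apply]
  rw [hsx, hτd b hb, hbx]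

theorem exists_sub_d_mem (hc : IsClassMap (restrictRep e ρ) n c)
    (hs : Function.LeftInverse e.proj s) {p N : ℕ} (hN : N = p + n) {f : (csComplex ρ).X N}
    (hf : f ∈ (hsFiltration e ρ).Z 1 p N) (h0 : inducedML c s p N hN (ev ρ N f) = 0) :
    ∃ v ∈ (hsFiltration e ρ).F p (N - 1),
      f - (csComplex ρ).d (N - 1) N v ∈ (hsFiltration e ρ).F (p + 1) N := by
  have hd : VanishesOn e (p + 1) (N + 1) (ev ρ (N + 1) ((csComplex ρ).d N (N + 1) f)) := hf.2
  rw [ev_d] at hd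
  cases n with
  | zero =>
    refine ⟨0, zero_mem _, ?_⟩
    rw [map_zero, sub_zero]
    refine (vanishesOn_succ_iff e hN (ev_mem ρ N f)).2 ?_
    ext1 x
    refine hc.eq_zero ((vanishesOn_succ_ce_iff e ρ hN (ev_mem ρ N f) hf.1).1 hd x) ?_
    rw [← VanishesOn.inducedML_comp_proj hs hN hf.1, h0]
    rfl
  | succ n =>
    obtain ⟨N, rfl⟩ : ∃ N', N = N' + 1 := ⟨p + n, by omega⟩
    obtain ⟨v, hv, hvp, hfv⟩ := exists_vanishesOn_sub_ce hc hs hN (ev_mem ρ _ f) hf.1 hd h0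
    obtain ⟨v, rfl⟩ := exists_ev_eq ρ hv
    rw [← ev_d, ← map_sub] at hfv
    exact ⟨v, hvp, hfv⟩

variable (e ρ) in
theorem hsFiltration_isFirstQuadrant : (hsFiltration e ρ).IsFirstQuadrant where
  eq_top p n hp := by
    refine eq_top_iff.2 fun f _ x S hS => ?_
    have := S.card_le_univ
    rw [Fintype.card_fin] at this
    omega
  eq_bot p n hp := by
    refine eq_bot_iff.2 fun f hf => (Submodule.mem_bot _).2 (ev_injective ρ n ?_)
    rw [map_zero]
    ext x
    exact hf x ∅ (by rw [Finset.card_empty]; push_cast; omega) (by simp)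

/-- The map `inducedML` between symmetric cochains: the comparison of the cochains on `g` with the
complex computing `HS(q, HSⁿ(h, M))`. -/
noncomputable def induced (c : ML 𝔽 h M n →ₗ[𝔽] HS (restrictRep e ρ) n) (s : q →ₗ[𝔽] g)
    (p N : ℕ) (hN : N = p + n) : (csComplex ρ).X N →ₗ[𝔽] (csComplex (quotRep e ρ n)).X p :=
  ((inducedML c s p N hN ∘ₗ ev ρ N).codRestrict (CS 𝔽 q (HS (restrictRep e ρ) n) p)
    fun f => inducedML_mem_CS c s hN (ev_mem ρ N f) :
      (csComplex ρ).X N →ₗ[𝔽] CS 𝔽 q (HS (restrictRep e ρ) n) p)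

theorem ev_induced {p N : ℕ} (hN : N = p + n) (f : (csComplex ρ).X N) :
    ev (quotRep e ρ n) p (induced c s p N hN f) = inducedML c s p N hN (ev ρ N f) := rfl

theorem induced_eq_zero_iff {p N : ℕ} (hN : N = p + n) (f : (csComplex ρ).X N) :
    induced c s p N hN f = 0 ↔ inducedML c s p N hN (ev ρ N f) = 0 := by
  rw [← ev_induced, map_eq_zero_iff _ (ev_injective (quotRep e ρ n) p)]

theorem induced_eq_zero_of_mem {p N : ℕ} (hN : N = p + n) {f : (csComplex ρ).X N}
    (hf : f ∈ (hsFiltration e ρ).F (p + 1) N) : induced c s p N hN f = 0 := by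
  rw [induced_eq_zero_iff]
  ext x
  rw [inducedML_apply, (vanishesOn_succ_iff e hN (ev_mem ρ N f)).1 hf]
  exact map_zero c

theorem induced_d (hc : IsClassMap (restrictRep e ρ) n c) (hs : Function.LeftInverse e.proj s)
    {p N : ℕ} (hN : N = p + n) (hN' : N + 1 = p + 1 + n) {f : (csComplex ρ).X N}
    (hf : f ∈ (hsFiltration e ρ).Z 1 p N) :
    induced c s (p + 1) (N + 1) hN' ((csComplex ρ).d N (N + 1) f) =
      (csComplex (quotRep e ρ n)).d p (p + 1) (induced c s p N hN f) := by
  refine ev_injective (quotRep e ρ n) (p + 1) ?_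
  have hd : VanishesOn e (p + 1) (N + 1) (ev ρ (N + 1) ((csComplex ρ).d N (N + 1) f)) := hf.2
  rw [ev_d] at hd
  rw [ev_induced, ev_d, ev_d, ev_induced, inducedML_ce hc hs hN hN' (ev_mem ρ N f) hf.1 hd]

theorem d_induced_eq_zero (hc : IsClassMap (restrictRep e ρ) n c)
    (hs : Function.LeftInverse e.proj s) {p N : ℕ} (hN : N = p + n) {f : (csComplex ρ).X N}
    (hf : f ∈ (hsFiltration e ρ).Z 2 p N) :
    (csComplex (quotRep e ρ n)).d p (p + 1) (induced c s p N hN f) = 0 := by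
  have hN' : N + 1 = p + 1 + n := by omega
  rw [← induced_d hc hs hN hN' (Filtration.Z_mono _ le_rfl (by omega) _ hf)]
  exact induced_eq_zero_of_mem hN' (Filtration.d_mem_F _ rfl (by push_cast; omega) hf)

theorem induced_zero_d_eq_zero (hc : IsClassMap (restrictRep e ρ) n c) {N : ℕ} (hN : N = 0 + n)
    (v : (csComplex ρ).X (N - 1)) :
    induced c s 0 N hN ((csComplex ρ).d (N - 1) N v) = 0 := by
  obtain rfl : N = n := by omega
  cases N with
  | zero =>
    rw [(csComplex ρ).shape (0 - 1) 0 (by simp)]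
    exact map_zero _
  | succ n =>
    rw [induced_eq_zero_iff]
    ext x
    change inducedML c s 0 (n + 1) hN (ev ρ (n + 1) ((csComplex ρ).d n (n + 1) v)) x = 0
    rw [inducedML_apply, ev_d, splitRes_zero_ce e ρ hN (Nat.zero_add n).symm,
      LinearMap.compMultilinearMap_apply, hc.apply_ce (splitRes_apply_mem_CS _ _ (ev_mem ρ n v) _)]

theorem exists_induced_eq (hc : IsClassMap (restrictRep e ρ) n c)
    (hs : Function.LeftInverse e.proj s) {p N : ℕ} (hN : N = p + n)
    (φ : (csComplex (quotRep e ρ n)).X p) :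
    ∃ f ∈ (hsFiltration e ρ).Z 1 p N, induced c s p N hN f = φ := by
  obtain ⟨f, hf, hfp, hd, hφ⟩ := exists_inducedML_eq hc hs hN (ev_mem (quotRep e ρ n) p φ)
  obtain ⟨f, rfl⟩ := exists_ev_eq ρ hf
  rw [← ev_d] at hd
  exact ⟨f, ⟨hfp, hd⟩, ev_injective (quotRep e ρ n) p hφ⟩

theorem exists_mem_Z_two_induced_eq (hc : IsClassMap (restrictRep e ρ) n c)
    (hs : Function.LeftInverse e.proj s) {p N : ℕ} (hN : N = p + n)
    {φ : (csComplex (quotRep e ρ n)).X p} (hφ : (csComplex (quotRep e ρ n)).d p (p + 1) φ = 0) :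
    ∃ f ∈ (hsFiltration e ρ).Z 2 p N, induced c s p N hN f = φ := by
  obtain ⟨f, hf, rfl⟩ := exists_induced_eq hc hs hN φ
  have hN' : N + 1 = p + 1 + n := by omega
  rw [← induced_d hc hs hN hN' hf, induced_eq_zero_iff] at hφ
  obtain ⟨v, hv, hfv⟩ : ∃ v ∈ (hsFiltration e ρ).F (p + 1 : ℕ) N,
      (csComplex ρ).d N (N + 1) f - (csComplex ρ).d N (N + 1) v ∈
        (hsFiltration e ρ).F ((p + 1 : ℕ) + 1) (N + 1) :=
    exists_sub_d_mem hc hs hN'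
      (Filtration.mem_Z_of_d_eq_zero _ hf.2 (Filtration.d_d_apply ..) 1) hφ
  refine ⟨f - v, (Filtration.mem_Z _).2 ⟨sub_mem hf.1 (Filtration.anti _ _ _ _ (by omega) hv), ?_⟩,
    ?_⟩
  · rw [map_sub]
    exact Filtration.anti _ _ _ _ (by push_cast; omega) hfv
  · rw [map_sub, induced_eq_zero_of_mem hN hv, sub_zero]

theorem mem_B_two_of_induced_eq_zero (hc : IsClassMap (restrictRep e ρ) n c)
    (hs : Function.LeftInverse e.proj s) {p N : ℕ} (hN : N = p + n) {f : (csComplex ρ).X N}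
    (hf : f ∈ (hsFiltration e ρ).Z 2 p N) (h0 : induced c s p N hN f = 0) :
    f ∈ (hsFiltration e ρ).B 2 p N := by
  obtain ⟨v, hv, hfv⟩ := exists_sub_d_mem hc hs hN (Filtration.Z_mono _ le_rfl (by omega) _ hf)
    ((induced_eq_zero_iff hN f).1 h0)
  have hdv : v ∈ (hsFiltration e ρ).Z (2 - 1) (p - 2 + 1) (N - 1) :=
    (Filtration.mem_Z _).2 ⟨Filtration.anti _ _ _ _ (by omega) hv,
      Filtration.anti _ _ p _ (by omega) (Filtration.d_mem _ _ _ _ _ hv)⟩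
  refine (Filtration.mem_B _).2 ⟨_, (Filtration.mem_Z _).2 ⟨hfv, ?_⟩, v, hdv,
    (sub_add_cancel _ _).symm⟩
  rw [map_sub, Filtration.d_d_apply, sub_zero]
  exact Filtration.anti _ _ _ _ (by omega) hf.2

theorem exists_d_eq_induced_of_mem_B_two (hc : IsClassMap (restrictRep e ρ) n c)
    (hs : Function.LeftInverse e.proj s) {p N : ℕ} (hN : N = p + n) {f : (csComplex ρ).X N}
    (hf : f ∈ (hsFiltration e ρ).B 2 p N) :
    ∃ ψ, (csComplex (quotRep e ρ n)).d (p - 1) p ψ = induced c s p N hN f := by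
  obtain ⟨a, ha, b, hb, rfl⟩ := (Filtration.mem_B _).1 hf
  rw [map_add, induced_eq_zero_of_mem hN ha.1, zero_add]
  cases p with
  | zero => exact ⟨0, by rw [map_zero, induced_zero_d_eq_zero hc hN]⟩
  | succ p =>
    obtain ⟨N, rfl⟩ : ∃ N', N = N' + 1 := ⟨p + n, by omega⟩
    refine ⟨induced c s p N (by omega) b, (induced_d hc hs _ hN ?_).symm⟩
    exact Filtration.Z_mono _ (by push_cast; omega) (by push_cast; omega) _ hb

theorem mem_B_two_of_d_eq_induced (hc : IsClassMap (restrictRep e ρ) n c)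
    (hs : Function.LeftInverse e.proj s) {p N : ℕ} (hN : N = p + n) {f : (csComplex ρ).X N}
    (hf : f ∈ (hsFiltration e ρ).Z 2 p N) {ψ : (csComplex (quotRep e ρ n)).X (p - 1)}
    (hψ : (csComplex (quotRep e ρ n)).d (p - 1) p ψ = induced c s p N hN f) :
    f ∈ (hsFiltration e ρ).B 2 p N := by
  cases p with
  | zero =>
    rw [(csComplex (quotRep e ρ n)).shape (0 - 1) 0 (by simp)] at hψ
    exact mem_B_two_of_induced_eq_zero hc hs hN hf hψ.symm
  | succ p =>
    obtain ⟨N, rfl⟩ : ∃ N', N = N' + 1 := ⟨p + n, by omega⟩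
    obtain ⟨w, hw, rfl⟩ := exists_induced_eq (N := N) hc hs (by omega) ψ
    have hdw : (csComplex ρ).d N (N + 1) w ∈ (hsFiltration e ρ).B 2 (p + 1 : ℕ) (N + 1) :=
      Filtration.d_mem_B_of_mem_Z _ _
        (Filtration.Z_mono _ (by push_cast; omega) (by push_cast; omega) _ hw)
    have hfw : f - (csComplex ρ).d N (N + 1) w ∈ (hsFiltration e ρ).Z 2 (p + 1 : ℕ) (N + 1) :=
      sub_mem hf (Filtration.mem_Z_of_d_eq_zero _ (Filtration.d_mem_F _ rfl (by push_cast; rfl) hw)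
        (Filtration.d_d_apply ..) 2)
    rw [← sub_add_cancel f ((csComplex ρ).d N (N + 1) w)]
    refine add_mem (mem_B_two_of_induced_eq_zero hc hs hN hfw ?_) hdw
    rw [map_sub, induced_d hc hs _ hN hw, sub_eq_zero]
    exact hψ.symm

theorem isInducedCochain_induced (hc : IsClassMap (restrictRep e ρ) n c)
    (hs : Function.LeftInverse e.proj s) {p : ℕ} {f : (csComplex ρ).X (p + n)}
    (hf : f ∈ (hsFiltration e ρ).Z 1 p (p + n)) :
    IsInducedCochain e ρ p n f (induced c s p (p + n) rfl f) := by
  intro x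
  obtain ⟨w, hw⟩ := exists_ev_eq (restrictRep e ρ)
    (splitRes_apply_mem_CS e.incl rfl (ev_mem ρ (p + n) f) x)
  have hd : VanishesOn e (p + 1) (p + n + 1) (ev ρ (p + n + 1) ((csComplex ρ).d _ _ f)) := hf.2
  rw [ev_d] at hd
  have hcocycle := (vanishesOn_succ_ce_iff e ρ rfl (ev_mem ρ (p + n) f) hf.1).1 hd x
  refine ⟨w, fun y => ?_, ?_⟩
  · rw [hw, splitRes_apply]
    rfl
  · rw [ev_induced, VanishesOn.inducedML_comp_proj hs rfl hf.1, ← hw]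
    exact hc.isClassOf (by rw [hw, hcocycle])

variable (e ρ) in
theorem exists_page_two_equiv (p n : ℕ) :
    ∃ ε : ((hsFiltration e ρ).page 2).X (p, n) ≃ₗ[𝔽] HS (quotRep e ρ n) p,
      ∀ z : (hsFiltration e ρ).Z 2 p (p + n), ∃ φ : (csComplex (quotRep e ρ n)).X p,
        IsInducedCochain e ρ p n z φ ∧
          IsClassOf (csComplex (quotRep e ρ n)) p φ
            (ε ((hsFiltration e ρ).toPage 2 (p, n) z)) := by
  obtain ⟨c, hc⟩ := exists_isClassMap (restrictRep e ρ) n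
  obtain ⟨s, hs'⟩ := e.proj.exists_rightInverse_of_surjective
    (LinearMap.range_eq_top.2 e.proj_surjective)
  have hs : Function.LeftInverse e.proj s := LinearMap.congr_fun hs'
  obtain ⟨χ, hχ⟩ := exists_linear_isClassOf
    (induced c s p (p + n) rfl ∘ₗ ((hsFiltration e ρ).Z 2 p (p + n)).subtype)
    fun z => d_induced_eq_zero hc hs rfl z.2
  have hsurj : Function.Surjective χ := fun a => by
    obtain ⟨φ, hφ⟩ := isClassOf_surjective a
    obtain ⟨f, hf, rfl⟩ := exists_mem_Z_two_induced_eq hc hs rfl (hφ.d_eq_zero (p + 1))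
    exact ⟨⟨f, hf⟩, (hχ _).unique hφ⟩
  have hker (z : (hsFiltration e ρ).Z 2 p (p + n)) :
      χ z = 0 ↔ z ∈ ((hsFiltration e ρ).B 2 p (p + n)).submoduleOf _ :=
    (hχ z).eq_zero_iff.trans ⟨fun ⟨_, hψ⟩ => mem_B_two_of_d_eq_induced hc hs rfl z.2 hψ,
      fun hz => exists_d_eq_induced_of_mem_B_two hc hs rfl hz⟩
  obtain ⟨ε, hε⟩ := exists_quotient_equiv _ χ hsurj hker
  refine ⟨ε, fun z => ⟨_, isInducedCochain_induced hc hs ?_, (hε z).symm ▸ hχ z⟩⟩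
  exact Filtration.Z_mono _ le_rfl (by omega) _ z.2

end HochschildSerre

end CommLie

theorem mainTheorem3
    {𝔽 : Type u} {h : Type vh} {g : Type vg} {q : Type vq} {M : Type w} [Field 𝔽] [CharP 𝔽 2]
    [AddCommGroup h] [Module 𝔽 h] [CommLieAlgebra 𝔽 h]
    [AddCommGroup g] [Module 𝔽 g] [CommLieAlgebra 𝔽 g]
    [AddCommGroup q] [Module 𝔽 q] [CommLieAlgebra 𝔽 q]
    [AddCommGroup M] [Module 𝔽 M]
    (e : CommLieExtension 𝔽 h g q) (ρ : CommLieRep 𝔽 g M) :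
    -- a first quadrant cohomological spectral sequence starting at `E₀` ...
    ∃ (E : CohomologicalSpectralSequenceNat (ModuleCat.{max vg w} 𝔽) 0)
      -- ... whose pages are those of the filtration by the number of arguments in `h`, ...
      (α : ∀ (r : ℤ) (hr : 0 ≤ r), E.page r hr ≅ (CommLie.hsFiltration e ρ).page r),
      -- ... the isomorphisms `H(E_r) ≅ E_{r+1}` being the identity on representatives,
      (∀ (r : ℤ) (hr : 0 ≤ r) (pq : ℕ × ℕ)
          (z : (CommLie.csComplex ρ).X (pq.1 + pq.2))
          (hz : z ∈ (CommLie.hsFiltration e ρ).Z r pq.1 (pq.1 + pq.2))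
          (hz' : z ∈ (CommLie.hsFiltration e ρ).Z (r + 1) pq.1 (pq.1 + pq.2))
          (k : (E.page r hr).cycles pq),
          (α r hr).hom.f pq ((E.page r hr).iCycles pq k) =
              (CommLie.hsFiltration e ρ).toPage r pq ⟨z, hz⟩ →
            (α (r + 1) (by omega)).hom.f pq
                ((E.iso r (r + 1) pq rfl hr).hom ((E.page r hr).homologyπ pq k)) =
              (CommLie.hsFiltration e ρ).toPage (r + 1) pq ⟨z, hz'⟩) ∧
      -- `E₂^{p,n} ≅ HSᵖ(q, HSⁿ(h, M))`, by restriction of cochains,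
      (∀ p n : ℕ, ∃ ε : (E.page 2 (by norm_num)).X (p, n) ≃ₗ[𝔽]
          CommLie.HS (CommLie.quotRep e ρ n) p,
        ∀ (a : (E.page 2 (by norm_num)).X (p, n))
          (z : (CommLie.hsFiltration e ρ).Z 2 p (p + n)),
          (α 2 (by norm_num)).hom.f (p, n) a = (CommLie.hsFiltration e ρ).toPage 2 (p, n) z →
            ∃ φ : (CommLie.csComplex (CommLie.quotRep e ρ n)).X p,
              CommLie.IsInducedCochain e ρ p n z φ ∧
              CommLie.IsClassOf (CommLie.csComplex (CommLie.quotRep e ρ n)) p φ (ε a)) ∧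
      -- convergence to `HS^•(g, M)`: the induced filtration of `HSⁿ(g, M)` is finite, ...
      (∀ n : ℕ, (CommLie.hsFiltration e ρ).FH 0 n = ⊤ ∧
        (CommLie.hsFiltration e ρ).FH (n + 1) n = ⊥) ∧
      -- ... and its graded pieces are the stable values `E_r^{p,n}`, `r > max(p, n + 1)`.
      (∀ (p n : ℕ) (r : ℤ) (hr : 0 ≤ r), (p : ℤ) < r → (n : ℤ) + 1 < r →
        ∃ ε : (E.page r hr).X (p, n) ≃ₗ[𝔽] (CommLie.hsFiltration e ρ).grH p (p + n),
          ∀ (a : (E.page r hr).X (p, n)) (z : (CommLie.hsFiltration e ρ).Z r p (p + n)),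
            (α r hr).hom.f (p, n) a = (CommLie.hsFiltration e ρ).toPage r (p, n) z →
              ∃ b : (CommLie.hsFiltration e ρ).FH p (p + n),
                CommLie.IsClassOf (CommLie.csComplex ρ) (p + n) z b ∧
                ε a = Submodule.Quotient.mk b) := by
  have hΦ := CommLie.hsFiltration_isFirstQuadrant e ρ
  refine ⟨hΦ.spectralSequence, fun r _ => Iso.refl _, ?_, ?_, ?_, ?_⟩
  · intro r hr pq z hz hz' k hk
    exact (hΦ.exists_homology_iso hr pq).choose_spec z hz hz' k hk
  · intro p n
    obtain ⟨ε, hε⟩ := CommLie.exists_page_two_equiv e ρ p n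
    refine ⟨ε, fun a z ha => ?_⟩
    obtain ⟨φ, hφ, hφ'⟩ := hε z
    exact ⟨φ, hφ, (show a = _ from ha) ▸ hφ'⟩
  · exact fun n => ⟨hΦ.FH_zero n, hΦ.FH_succ n⟩
  · intro p n r hr hp hn
    obtain ⟨ε, hε⟩ := hΦ.exists_page_equiv_grH p n r hp hn
    refine ⟨ε, fun a z ha => ?_⟩
    obtain ⟨b, hb, hb'⟩ := hε z
    exact ⟨b, hb, (show a = _ from ha) ▸ hb'⟩
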